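/- Conventions. All objects are smooth, $\Gamma$ denotes sections over arbitrary open sets, $d\alpha(X,Y)=X(\alpha(Y))-Y(\alpha(X))-\alpha([X,Y])$ for a $1$-form $\alpha$, $\alpha\odot\beta=\alpha\otimes\beta+\beta\otimes\alpha$, $\mathcal L$ is the Lie derivative, and brackets and tensors are extended $\mathbb C$-bilinearly to $T^{\mathbb C}M$. Let $(M^{2m+2},g)$ be a Lorentzian manifold of signature $(-,+,\dots,+)$, let $\mathcal R,\mathcal R^*\subset TM$ be null line subbundles with $TM=\mathcal R^*\oplus\mathcal R^\perp$, and put $\mathcal S=\mathcal R^\perp\cap(\mathcal R^*)^\perp$ (the screen bundle) and $g_{\mathcal S}=g|_{\mathcal S}$. Let $\nu\in\Gamma(\mathcal R)$, $\nu^*\in\Gamma(\mathcal R^*)$ be globally defined with $g(\nu,\nu^*)=1$ (an optical pairing), and put $\sigma=g(\nu^*,\cdot)$, $\sigma^*=g(\nu,\cdot)$. For a vector $X$ write $X_{\mathcal S}=X-\sigma(X)\nu-\sigma^*(X)\nu^*$ for its screen component. Assume that * the pairing is adapted: $\mathcal L_\nu\sigma^*=\mathcal L_{\nu^*}\sigma^*=0$;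 * $\mathcal R$ is maximally twisted: $[\Gamma(\mathcal R),\Gamma(\mathcal R^\perp)]\subset\Gamma(\mathcal R^\perp)$ and $d\sigma^*|_{\mathcal R^\perp}$ has rank $2m$ everywhere; * the endomorphism $J_{\mathcal S}$ of $\mathcal S$ given by $g_{\mathcal S}(J_{\mathcal S}X,Y)=d\sigma^*(X,Y)$ is an almost Hermitian structure for $g_{\mathcal S}$, i.e. $J_{\mathcal S}^2=-\mathrm{id}$ and $g_{\mathcal S}(J_{\mathcal S}X,J_{\mathcal S}Y)=g_{\mathcal S}(X,Y)$. (That is, $M$ is an almost Fefferman-Robinson manifold with adapted optical pairing.) Let $J$ be the extension of $J_{\mathcal S}$ to $TM$ by $0$ on $\mathcal R\oplus\mathcal R^*$, let $\omega(X,Y)=g(JX,Y)$, let $\mathcal S^{1,0},\mathcal S^{0,1}\subset\mathcal S^{\mathbb C}$ be the $\pm\sqrt{-1}$-eigenbundles of $J_{\mathcal S}$, and let $\mathcal N=\mathcal R^{\mathbb C}\oplus\mathcal S^{1,0}$ be the associated almost Robinson structure. For $X\in T^{\mathbb C}M$ let $X^{1,0}$, $X^{0,1}$ be the components of $X_{\mathcal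 S}$ in $\mathcal S^{\mathbb C}=\mathcal S^{1,0}\oplus\mathcal S^{0,1}$, and for a bilinear form $h$ put $$h_{\mathcal S}^{(2,0)+(0,2)}(X,Y)=h(X^{1,0},Y^{1,0})+h(X^{0,1},Y^{0,1}).$$ Then: 1. $\mathcal N$ is partially integrable: $[\Gamma(\mathcal N),\Gamma(\mathcal N)]\subset\Gamma(\mathcal N+\overline{\mathcal N})$. 2. $\mathcal L_\nu\omega=\mathcal L_{\nu^*}\omega=0$ and $[\nu,\nu^*]_{\mathcal S}=0$. 3. $\mathcal L_\nu g=(\mathcal L_\nu g)_{\mathcal S}^{(2,0)+(0,2)}+\sigma^*\odot\mathcal L_\nu\sigma$. -/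

import Mathlib

open scoped Manifold ContDiff TensorProduct

noncomputable section

namespace RobinsonGeometry

section Pullback

variable {V W : Type*} [AddCommGroup V] [Module ℝ V] [TopologicalSpace V]
  [AddCommGroup W] [Module ℝ W] [TopologicalSpace W]

/-- The pullback `(u, v) ↦ h(A u, A v)` of a bilinear form `h` under a linear map `A`. -/
def pullbackBilin (h : V →L[ℝ] V →L[ℝ] ℝ) (A : W →L[ℝ] V) : W →L[ℝ] W →L[ℝ] ℝ :=
  (ContinuousLinearMap.precomp ℝ A).comp (h.comp A)

end Pullback

section Calculus

variable {E : Type*} [NormedAddCommGroup E] [NormedSpace ℝ E]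
  {M : Type*} [TopologicalSpace M] [ChartedSpace E M]

/-- The vector field `X` is smooth on the set `U`. -/
def IsSmoothFieldOn [IsManifold 𝓘(ℝ, E) ∞ M]
    (X : (x : M) → TangentSpace 𝓘(ℝ, E) x) (U : Set M) : Prop :=
  ContMDiffOn 𝓘(ℝ, E) 𝓘(ℝ, E).tangent ∞ (fun x => (⟨x, X x⟩ : TangentBundle 𝓘(ℝ, E) M)) U

/-- The `(0,2)`-tensor field `h` is smooth (as a section of `Hom(TM, Hom(TM, ℝ))`). -/
def IsSmoothBilin [IsManifold 𝓘(ℝ, E) ∞ M]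
    (h : (x : M) → TangentSpace 𝓘(ℝ, E) x →L[ℝ] TangentSpace 𝓘(ℝ, E) x →L[ℝ] ℝ) : Prop :=
  ContMDiff 𝓘(ℝ, E) (𝓘(ℝ, E).prod 𝓘(ℝ, E →L[ℝ] E →L[ℝ] ℝ)) ∞
    (fun x => Bundle.TotalSpace.mk' (E →L[ℝ] E →L[ℝ] ℝ)
      (E := fun x : M => TangentSpace 𝓘(ℝ, E) x →L[ℝ] TangentSpace 𝓘(ℝ, E) x →L[ℝ] ℝ) x (h x))

/-- The field of endomorphisms `J` is smooth (as a section of `Hom(TM, TM)`). -/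
def IsSmoothEnd [IsManifold 𝓘(ℝ, E) ∞ M]
    (J : (x : M) → TangentSpace 𝓘(ℝ, E) x →L[ℝ] TangentSpace 𝓘(ℝ, E) x) : Prop :=
  ContMDiff 𝓘(ℝ, E) (𝓘(ℝ, E).prod 𝓘(ℝ, E →L[ℝ] E)) ∞
    (fun x => Bundle.TotalSpace.mk' (E →L[ℝ] E)
      (E := fun x : M => TangentSpace 𝓘(ℝ, E) x →L[ℝ] TangentSpace 𝓘(ℝ, E) x) x (J x))

/-- The differential at `y` of the inverse of the preferred chart at `x`. -/
def chartInvDeriv (x : M) (y : E) :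
    E →L[ℝ] TangentSpace 𝓘(ℝ, E) ((extChartAt 𝓘(ℝ, E) x).symm y) :=
  mfderiv 𝓘(ℝ, E) 𝓘(ℝ, E) (extChartAt 𝓘(ℝ, E) x).symm y

/-- The differential at `x` of the preferred chart at `x`. -/
def chartDeriv (x : M) : TangentSpace 𝓘(ℝ, E) x →L[ℝ] E :=
  mfderiv 𝓘(ℝ, E) 𝓘(ℝ, E) (extChartAt 𝓘(ℝ, E) x) x

/-- A vector field read in the preferred chart at `x`. -/
def chartField (x : M) (X : (x : M) → TangentSpace 𝓘(ℝ, E) x) : E → E :=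
  fun y => VectorField.mpullback 𝓘(ℝ, E) 𝓘(ℝ, E) (extChartAt 𝓘(ℝ, E) x).symm X y

/-- A `1`-form read in the preferred chart at `x` (pullback under the inverse of the chart). -/
def chartForm (x : M) (α : (x : M) → TangentSpace 𝓘(ℝ, E) x →L[ℝ] ℝ) : E → (E →L[ℝ] ℝ) :=
  fun y => (α ((extChartAt 𝓘(ℝ, E) x).symm y)).comp (chartInvDeriv x y)

/-- A `(0,2)`-tensor field read in the preferred chart at `x`
(pullback under the inverse of the chart). -/
def chartBilin (x : M)
    (h : (x : M) → TangentSpace 𝓘(ℝ, E) x →L[ℝ] TangentSpace 𝓘(ℝ, E) x →L[ℝ] ℝ) :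
    E → (E →L[ℝ] E →L[ℝ] ℝ) :=
  fun y => pullbackBilin (h ((extChartAt 𝓘(ℝ, E) x).symm y)) (chartInvDeriv x y)

/-- The exterior derivative of a `1`-form, with the convention
`dα(X, Y) = X(α(Y)) - Y(α(X)) - α([X, Y])`; in a chart,
`dα(u, v) = (D_u α)(v) - (D_v α)(u)`. -/
def extDerivForm (α : (x : M) → TangentSpace 𝓘(ℝ, E) x →L[ℝ] ℝ) (x : M) :
    TangentSpace 𝓘(ℝ, E) x →L[ℝ] TangentSpace 𝓘(ℝ, E) x →L[ℝ] ℝ :=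
  let D : E →L[ℝ] E →L[ℝ] ℝ := fderiv ℝ (chartForm x α) (extChartAt 𝓘(ℝ, E) x x)
  pullbackBilin (D - D.flip) (chartDeriv x)

/-- The Lie derivative `L_X α` of a `1`-form, `(L_X α)(Y) = X(α(Y)) - α([X, Y])`; in a chart,
`(L_X α)(v) = (D_X α)(v) + α(D_v X)`. -/
def lieDerivForm (X : (x : M) → TangentSpace 𝓘(ℝ, E) x)
    (α : (x : M) → TangentSpace 𝓘(ℝ, E) x →L[ℝ] ℝ) (x : M) :
    TangentSpace 𝓘(ℝ, E) x →L[ℝ] ℝ :=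
  let p : E := extChartAt 𝓘(ℝ, E) x x
  let DX : E →L[ℝ] E := fderiv ℝ (chartField x X) p
  (fderiv ℝ (chartForm x α) p (chartField x X p) + (chartForm x α p).comp DX).comp (chartDeriv x)

/-- The Lie derivative `L_X h` of a `(0,2)`-tensor field,
`(L_X h)(Y, Z) = X(h(Y, Z)) - h([X, Y], Z) - h(Y, [X, Z])`; in a chart,
`(L_X h)(u, v) = (D_X h)(u, v) + h(D_u X, v) + h(u, D_v X)`. -/
def lieDerivBilin (X : (x : M) → TangentSpace 𝓘(ℝ, E) x)
    (h : (x : M) → TangentSpace 𝓘(ℝ, E) x →L[ℝ] TangentSpace 𝓘(ℝ, E) x →L[ℝ] ℝ) (x : M) :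
    TangentSpace 𝓘(ℝ, E) x →L[ℝ] TangentSpace 𝓘(ℝ, E) x →L[ℝ] ℝ :=
  let p : E := extChartAt 𝓘(ℝ, E) x x
  let DX : E →L[ℝ] E := fderiv ℝ (chartField x X) p
  pullbackBilin (fderiv ℝ (chartBilin x h) p (chartField x X p)
    + (chartBilin x h p).bilinearComp DX (ContinuousLinearMap.id ℝ E)
    + (chartBilin x h p).bilinearComp (ContinuousLinearMap.id ℝ E) DX) (chartDeriv x)

end Calculus

section LinearAlgebra

variable {V : Type*} [AddCommGroup V] [Module ℝ V]

/-- The real part of a vector of `V^ℂ = ℂ ⊗ V`. -/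
def rePart : (ℂ ⊗[ℝ] V) →ₗ[ℝ] V :=
  (TensorProduct.lid ℝ V).toLinearMap ∘ₗ Complex.reLm.rTensor V

/-- The imaginary part of a vector of `V^ℂ = ℂ ⊗ V`. -/
def imPart : (ℂ ⊗[ℝ] V) →ₗ[ℝ] V :=
  (TensorProduct.lid ℝ V).toLinearMap ∘ₗ Complex.imLm.rTensor V

/-- The complex vector `u + √-1 v` of `V^ℂ`. -/
def complexVec (u v : V) : ℂ ⊗[ℝ] V := (1 : ℂ) ⊗ₜ[ℝ] u + Complex.I ⊗ₜ[ℝ] v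

/-- Complex conjugation on `V^ℂ`. -/
def conjVec (Z : ℂ ⊗[ℝ] V) : ℂ ⊗[ℝ] V := complexVec (rePart Z) (-imPart Z)

/-- The symmetric product `α ⊙ β = α ⊗ β + β ⊗ α` of two linear forms. -/
def symProd (α β : V →ₗ[ℝ] ℝ) : LinearMap.BilinForm ℝ V :=
  LinearMap.BilinForm.linMulLin α β + LinearMap.BilinForm.linMulLin β α

/-- For an endomorphism `j` of `V`, the map `Z ↦ (Z - √-1 j Z) / 2` of `V^ℂ`; on the complexification
of a subspace where `j² = -1` it is the projection to the `√-1`-eigenspace of `j`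
along the `(-√-1)`-eigenspace. -/
def proj10 (j : V →ₗ[ℝ] V) : (ℂ ⊗[ℝ] V) →ₗ[ℂ] (ℂ ⊗[ℝ] V) :=
  (1 / 2 : ℂ) • (LinearMap.id - Complex.I • j.baseChange ℂ)

/-- The map `Z ↦ (Z + √-1 j Z) / 2` of `V^ℂ`, projection to the `(-√-1)`-eigenspace where
`j² = -1`. -/
def proj01 (j : V →ₗ[ℝ] V) : (ℂ ⊗[ℝ] V) →ₗ[ℂ] (ℂ ⊗[ℝ] V) :=
  (1 / 2 : ℂ) • (LinearMap.id + Complex.I • j.baseChange ℂ)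

end LinearAlgebra

section ComplexFields

variable {E : Type*} [NormedAddCommGroup E] [NormedSpace ℝ E]
  {M : Type*} [TopologicalSpace M] [ChartedSpace E M] [IsManifold 𝓘(ℝ, E) ∞ M]

/-- A section of the complexified tangent bundle is smooth on `U` when its real and imaginary
parts are. -/
def IsSmoothComplexFieldOn (Z : (x : M) → ℂ ⊗[ℝ] TangentSpace 𝓘(ℝ, E) x) (U : Set M) : Prop :=
  IsSmoothFieldOn (fun x => rePart (Z x)) U ∧ IsSmoothFieldOn (fun x => imPart (Z x)) U

/-- The `ℂ`-bilinear extension of the Lie bracket to complex vector fields. -/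
def complexBracket (Z W : (x : M) → ℂ ⊗[ℝ] TangentSpace 𝓘(ℝ, E) x) (x : M) :
    ℂ ⊗[ℝ] TangentSpace 𝓘(ℝ, E) x :=
  complexVec
    (VectorField.mlieBracket 𝓘(ℝ, E) (fun y => rePart (Z y)) (fun y => rePart (W y)) x
      - VectorField.mlieBracket 𝓘(ℝ, E) (fun y => imPart (Z y)) (fun y => imPart (W y)) x)
    (VectorField.mlieBracket 𝓘(ℝ, E) (fun y => rePart (Z y)) (fun y => imPart (W y)) x
      + VectorField.mlieBracket 𝓘(ℝ, E) (fun y => imPart (Z y)) (fun y => rePart (W y)) x)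

/-- `[Γ(N), Γ(N)] ⊆ Γ(N + N̄)` for a complex subbundle `N` of the complexified tangent bundle;
sections are taken over arbitrary open sets. -/
def PartiallyIntegrable
    (N : (x : M) → Submodule ℂ (ℂ ⊗[ℝ] TangentSpace 𝓘(ℝ, E) x)) : Prop :=
  ∀ (U : Set M) (Z W : (x : M) → ℂ ⊗[ℝ] TangentSpace 𝓘(ℝ, E) x), IsOpen U →
    IsSmoothComplexFieldOn Z U → IsSmoothComplexFieldOn W U →
    (∀ x ∈ U, Z x ∈ N x) → (∀ x ∈ U, W x ∈ N x) →
    ∀ x ∈ U, ∃ A ∈ N x, ∃ B ∈ N x, complexBracket Z W x = A + conjVec B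

end ComplexFields

section Optical

variable {E : Type*} [NormedAddCommGroup E] [NormedSpace ℝ E]
  {M : Type*} [TopologicalSpace M] [ChartedSpace E M] [IsManifold 𝓘(ℝ, E) ∞ M]

/-- `g` is a Lorentzian metric on the manifold `M` of dimension `2m + 2`, of signature
`(-, +, …, +)`. -/
structure IsLorentzian (m : ℕ)
    (g : (x : M) → TangentSpace 𝓘(ℝ, E) x →L[ℝ] TangentSpace 𝓘(ℝ, E) x →L[ℝ] ℝ) : Prop where
  smooth : IsSmoothBilin g
  symm : ∀ (x : M) (u v : TangentSpace 𝓘(ℝ, E) x), g x u v = g x v u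
  signature : ∀ x : M, ∃ b : Module.Basis (Fin (2 * m + 2)) ℝ (TangentSpace 𝓘(ℝ, E) x),
    ∀ i j, g x (b i) (b j) = if i = j then (if i = 0 then -1 else 1) else 0

/-- `L` is a smooth line subbundle of `TM` which is null for `g`. -/
structure IsNullLineSubbundle
    (g : (x : M) → TangentSpace 𝓘(ℝ, E) x →L[ℝ] TangentSpace 𝓘(ℝ, E) x →L[ℝ] ℝ)
    (L : (x : M) → Submodule ℝ (TangentSpace 𝓘(ℝ, E) x)) : Prop where
  line : ∀ x : M, ∃ (U : Set M) (X : (x : M) → TangentSpace 𝓘(ℝ, E) x), IsOpen U ∧ x ∈ U ∧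
    IsSmoothFieldOn X U ∧ ∀ y ∈ U, X y ≠ 0 ∧ L y = Submodule.span ℝ {X y}
  null : ∀ (x : M), ∀ u ∈ L x, ∀ v ∈ L x, g x u v = 0

/-- The `g`-orthogonal complement of a subbundle of `TM`. -/
def orth (g : (x : M) → TangentSpace 𝓘(ℝ, E) x →L[ℝ] TangentSpace 𝓘(ℝ, E) x →L[ℝ] ℝ)
    (L : (x : M) → Submodule ℝ (TangentSpace 𝓘(ℝ, E) x)) (x : M) :
    Submodule ℝ (TangentSpace 𝓘(ℝ, E) x) where
  carrier := {v | ∀ u ∈ L x, g x u v = 0}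
  zero_mem' := by
    intro u _
    simp
  add_mem' := by
    intro a b ha hb u hu
    rw [map_add, ha u hu, hb u hu, add_zero]
  smul_mem' := by
    intro c a ha u hu
    rw [map_smul, ha u hu, smul_zero]

/-- `R` is an almost optical structure (a null line subbundle) for `g`, and `Rs` is a null line
subbundle with `TM = Rs ⊕ R^⊥`. -/
structure IsAlmostOptical
    (g : (x : M) → TangentSpace 𝓘(ℝ, E) x →L[ℝ] TangentSpace 𝓘(ℝ, E) x →L[ℝ] ℝ)
    (R Rs : (x : M) → Submodule ℝ (TangentSpace 𝓘(ℝ, E) x)) : Prop where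
  null_line : IsNullLineSubbundle g R
  null_line_dual : IsNullLineSubbundle g Rs
  isCompl : ∀ x : M, IsCompl (Rs x) (orth g R x)

/-- `[Γ(R), Γ(R^⊥)] ⊆ Γ(R^⊥)`. -/
def IsGeodetic (g : (x : M) → TangentSpace 𝓘(ℝ, E) x →L[ℝ] TangentSpace 𝓘(ℝ, E) x →L[ℝ] ℝ)
    (R : (x : M) → Submodule ℝ (TangentSpace 𝓘(ℝ, E) x)) : Prop :=
  ∀ (U : Set M) (X Y : (x : M) → TangentSpace 𝓘(ℝ, E) x), IsOpen U →
    IsSmoothFieldOn X U → IsSmoothFieldOn Y U →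
    (∀ x ∈ U, X x ∈ R x) → (∀ x ∈ U, Y x ∈ orth g R x) →
    ∀ x ∈ U, VectorField.mlieBracket 𝓘(ℝ, E) X Y x ∈ orth g R x

/-- The `1`-form `X^♭ = g(X, ·)`. -/
def flat (g : (x : M) → TangentSpace 𝓘(ℝ, E) x →L[ℝ] TangentSpace 𝓘(ℝ, E) x →L[ℝ] ℝ)
    (X : (x : M) → TangentSpace 𝓘(ℝ, E) x) (x : M) : TangentSpace 𝓘(ℝ, E) x →L[ℝ] ℝ :=
  g x (X x)

/-- `(ν, νs)` is a `g`-optical pairing: smooth sections of `R` and `Rs` with `g(ν, νs) = 1`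
(in particular neither vanishes). The associated optical forms are
`σ = flat g νs` and `σ* = flat g ν`. -/
structure IsOpticalPairing
    (g : (x : M) → TangentSpace 𝓘(ℝ, E) x →L[ℝ] TangentSpace 𝓘(ℝ, E) x →L[ℝ] ℝ)
    (R Rs : (x : M) → Submodule ℝ (TangentSpace 𝓘(ℝ, E) x))
    (ν νs : (x : M) → TangentSpace 𝓘(ℝ, E) x) : Prop where
  smooth : IsSmoothFieldOn ν Set.univ
  smooth_dual : IsSmoothFieldOn νs Set.univ
  mem : ∀ x, ν x ∈ R x
  mem_dual : ∀ x, νs x ∈ Rs x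
  pairing : ∀ x, g x (ν x) (νs x) = 1

/-- The optical pairing is adapted: `L_ν σ* = L_νs σ* = 0`. -/
def IsAdapted (g : (x : M) → TangentSpace 𝓘(ℝ, E) x →L[ℝ] TangentSpace 𝓘(ℝ, E) x →L[ℝ] ℝ)
    (ν νs : (x : M) → TangentSpace 𝓘(ℝ, E) x) : Prop :=
  (∀ x, lieDerivForm ν (flat g ν) x = 0) ∧ (∀ x, lieDerivForm νs (flat g ν) x = 0)

/-- `R` is geodetic and, for the section `ν` of `R`, the restriction of `dσ*`, `σ* = ν^♭`, to
`R^⊥` has rank `2m` everywhere. -/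
def IsMaximallyTwisted (m : ℕ)
    (g : (x : M) → TangentSpace 𝓘(ℝ, E) x →L[ℝ] TangentSpace 𝓘(ℝ, E) x →L[ℝ] ℝ)
    (R : (x : M) → Submodule ℝ (TangentSpace 𝓘(ℝ, E) x))
    (ν : (x : M) → TangentSpace 𝓘(ℝ, E) x) : Prop :=
  IsGeodetic g R ∧ ∀ x, Module.finrank ℝ (LinearMap.range
    ((extDerivForm (flat g ν) x).toBilinForm.restrict (orth g R x))) = 2 * m

/-- The screen bundle `S = R^⊥ ∩ Rs^⊥`. -/
def screen (g : (x : M) → TangentSpace 𝓘(ℝ, E) x →L[ℝ] TangentSpace 𝓘(ℝ, E) x →L[ℝ] ℝ)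
    (R Rs : (x : M) → Submodule ℝ (TangentSpace 𝓘(ℝ, E) x)) (x : M) :
    Submodule ℝ (TangentSpace 𝓘(ℝ, E) x) :=
  orth g R x ⊓ orth g Rs x

/-- The screen projection `u ↦ u_S = u - σ(u) ν - σ*(u) νs`. -/
def screenProj (g : (x : M) → TangentSpace 𝓘(ℝ, E) x →L[ℝ] TangentSpace 𝓘(ℝ, E) x →L[ℝ] ℝ)
    (ν νs : (x : M) → TangentSpace 𝓘(ℝ, E) x) (x : M) :
    TangentSpace 𝓘(ℝ, E) x →ₗ[ℝ] TangentSpace 𝓘(ℝ, E) x :=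
  LinearMap.id - (flat g νs x).toLinearMap.smulRight (ν x)
    - (flat g ν x).toLinearMap.smulRight (νs x)

/-- `J` is the extension by `0` on `R ⊕ Rs` of an endomorphism `J_S` of the screen bundle `S`
which is an almost Hermitian structure for `g_S`: a smooth complex structure on `S`
that is orthogonal for `g_S`. -/
structure IsAlmostHermitian
    (g : (x : M) → TangentSpace 𝓘(ℝ, E) x →L[ℝ] TangentSpace 𝓘(ℝ, E) x →L[ℝ] ℝ)
    (R Rs : (x : M) → Submodule ℝ (TangentSpace 𝓘(ℝ, E) x))
    (J : (x : M) → TangentSpace 𝓘(ℝ, E) x →L[ℝ] TangentSpace 𝓘(ℝ, E) x) : Prop where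
  smooth : IsSmoothEnd J
  zero_left : ∀ x, ∀ u ∈ R x, J x u = 0
  zero_right : ∀ x, ∀ u ∈ Rs x, J x u = 0
  maps_screen : ∀ x, ∀ u ∈ screen g R Rs x, J x u ∈ screen g R Rs x
  sq : ∀ x, ∀ u ∈ screen g R Rs x, J x (J x u) = -u
  orthogonal : ∀ x, ∀ u ∈ screen g R Rs x, ∀ v ∈ screen g R Rs x, g x (J x u) (J x v) = g x u v

/-- `(M, g, R, Rs)` with the adapted optical pairing `(ν, νs)` is an almost Fefferman-Robinson
manifold of dimension `2m + 2`, and `J` is the extension by `0` on `R ⊕ Rs` of the almost Hermitian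
structure `J_S = g_S⁻¹ ∘ dσ*|_S`. -/
structure IsAlmostFeffermanRobinson (m : ℕ)
    (g : (x : M) → TangentSpace 𝓘(ℝ, E) x →L[ℝ] TangentSpace 𝓘(ℝ, E) x →L[ℝ] ℝ)
    (R Rs : (x : M) → Submodule ℝ (TangentSpace 𝓘(ℝ, E) x))
    (ν νs : (x : M) → TangentSpace 𝓘(ℝ, E) x)
    (J : (x : M) → TangentSpace 𝓘(ℝ, E) x →L[ℝ] TangentSpace 𝓘(ℝ, E) x) : Prop where
  lorentzian : IsLorentzian m g
  optical : IsAlmostOptical g R Rs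
  pairing : IsOpticalPairing g R Rs ν νs
  adapted : IsAdapted g ν νs
  twisted : IsMaximallyTwisted m g R ν
  hermitian : IsAlmostHermitian g R Rs J
  screen_eq : ∀ x, ∀ u ∈ screen g R Rs x, ∀ v ∈ screen g R Rs x,
    g x (J x u) v = extDerivForm (flat g ν) x u v

/-- The Hermitian form extended to `TM`, `ω(X, Y) = g(J X, Y)`. -/
def hermitianForm
    (g : (x : M) → TangentSpace 𝓘(ℝ, E) x →L[ℝ] TangentSpace 𝓘(ℝ, E) x →L[ℝ] ℝ)
    (J : (x : M) → TangentSpace 𝓘(ℝ, E) x →L[ℝ] TangentSpace 𝓘(ℝ, E) x) (x : M) :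
    TangentSpace 𝓘(ℝ, E) x →L[ℝ] TangentSpace 𝓘(ℝ, E) x →L[ℝ] ℝ :=
  (g x).comp (J x)

/-- `S^{1,0}`, the `√-1`-eigenbundle of `J_S` in the complexified screen bundle. -/
def screen10 (g : (x : M) → TangentSpace 𝓘(ℝ, E) x →L[ℝ] TangentSpace 𝓘(ℝ, E) x →L[ℝ] ℝ)
    (R Rs : (x : M) → Submodule ℝ (TangentSpace 𝓘(ℝ, E) x))
    (J : (x : M) → TangentSpace 𝓘(ℝ, E) x →L[ℝ] TangentSpace 𝓘(ℝ, E) x) (x : M) :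
    Submodule ℂ (ℂ ⊗[ℝ] TangentSpace 𝓘(ℝ, E) x) :=
  (screen g R Rs x).baseChange ℂ ⊓
    Module.End.eigenspace ((J x).toLinearMap.baseChange ℂ) Complex.I

/-- The almost Robinson structure `N = R^ℂ ⊕ S^{1,0}` given by `R` and the almost Hermitian
structure `J_S` on the screen bundle. -/
def robinsonBundle
    (g : (x : M) → TangentSpace 𝓘(ℝ, E) x →L[ℝ] TangentSpace 𝓘(ℝ, E) x →L[ℝ] ℝ)
    (R Rs : (x : M) → Submodule ℝ (TangentSpace 𝓘(ℝ, E) x))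
    (J : (x : M) → TangentSpace 𝓘(ℝ, E) x →L[ℝ] TangentSpace 𝓘(ℝ, E) x) (x : M) :
    Submodule ℂ (ℂ ⊗[ℝ] TangentSpace 𝓘(ℝ, E) x) :=
  (R x).baseChange ℂ ⊔ screen10 g R Rs J x

/-- The `ℂ`-bilinear extension of a real bilinear form on `T_xM` to the complexification. -/
def complexExt {x : M} (h : TangentSpace 𝓘(ℝ, E) x →L[ℝ] TangentSpace 𝓘(ℝ, E) x →L[ℝ] ℝ) :
    LinearMap.BilinForm ℂ (ℂ ⊗[ℝ] TangentSpace 𝓘(ℝ, E) x) :=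
  LinearMap.BilinForm.baseChange ℂ h.toBilinForm

/-- The part `h_S^{(2,0)+(0,2)}` of a bilinear form `h`:
`(Z, W) ↦ h(Z^{1,0}, W^{1,0}) + h(Z^{0,1}, W^{0,1})`,
where `Z^{1,0}`, `Z^{0,1}` are the components of the screen projection `Z_S` in
`S^ℂ = S^{1,0} ⊕ S^{0,1}`, and `h` is extended complex bilinearly. -/
def part2002 (g : (x : M) → TangentSpace 𝓘(ℝ, E) x →L[ℝ] TangentSpace 𝓘(ℝ, E) x →L[ℝ] ℝ)
    (ν νs : (x : M) → TangentSpace 𝓘(ℝ, E) x)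
    (J : (x : M) → TangentSpace 𝓘(ℝ, E) x →L[ℝ] TangentSpace 𝓘(ℝ, E) x) (x : M)
    (h : TangentSpace 𝓘(ℝ, E) x →L[ℝ] TangentSpace 𝓘(ℝ, E) x →L[ℝ] ℝ) :
    LinearMap.BilinForm ℂ (ℂ ⊗[ℝ] TangentSpace 𝓘(ℝ, E) x) :=
  let p10 := proj10 (J x).toLinearMap ∘ₗ (screenProj g ν νs x).baseChange ℂ
  let p01 := proj01 (J x).toLinearMap ∘ₗ (screenProj g ν νs x).baseChange ℂ
  (complexExt h).comp p10 p10 + (complexExt h).comp p01 p01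

end Optical

end RobinsonGeometry

end

set_option maxSynthPendingDepth 3

/-! The crux is that $\omega=d\sigma^*$ on all of $TM$, not only on the screen. Since
$\sigma^*(\nu)=0$ and $\sigma^*(\nu^*)=1$ are constant, Cartan's formula turns adaptedness into
$\iota_\nu d\sigma^*=\iota_{\nu^*}d\sigma^*=0$. Thus both forms see only screen components, where
they agree by assumption (`hermitianForm_eq`).

Everything else follows. The Lie derivative commutes with $d$, so $\mathcal L_\nu\omega=\mathcal
L_{\nu^*}\omega=0$ (`lieDerivBilin_extDerivForm`). Contracting $\mathcal L_\nu\omega=0$ with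
$\nu^*$, which $\omega$ annihilates, leaves $\omega([\nu,\nu^*],\cdot)=0$, so $[\nu,\nu^*]$ has no
screen component (`screenProj_mlieBracket`).

For the metric, differentiating $\omega=g(J\cdot,\cdot)$ and $J^3=-J$ along $\nu$ shows that
$\mathcal L_\nu g$ changes sign under $J$ on the screen (`lieBilin_anti_invariant`), which means
type $(2,0)+(0,2)$. The contractions of $\mathcal L_\nu g$ with $\nu$ and $\nu^*$ supply the term
$\sigma^*\odot\mathcal L_\nu\sigma$ (`lieDerivBilin_metric`).

For partial integrability, $\mathcal N+\overline{\mathcal N}=(\mathcal R^\perp)^{\mathbb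
C}=\ker\sigma^*$, and sections of $\mathcal N$ satisfy $\sigma^*([Z,W])=-\omega(Z,W)=0$ because
$\omega$ has type $(1,1)$ (`partiallyIntegrable`).

The tensor operations at a point are defined in the preferred chart of that point. Differentiating
$d\sigma^*$ requires it on a whole neighbourhood in one chart, hence the chart-independence lemmas.
-/

noncomputable section

namespace RobinsonGeometry

open Filter Topology Function

/-! ### Cartan calculus on a normed space. -/

section FlatCalculus

variable {E : Type*} [NormedAddCommGroup E] [NormedSpace ℝ E]

/-- The Lie derivative of a `1`-form on a normed space. -/
def lieForm (X : E → E) (a : E → E →L[ℝ] ℝ) (p : E) : E →L[ℝ] ℝ :=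
  fderiv ℝ a p (X p) + (a p).comp (fderiv ℝ X p)

/-- The exterior derivative of a `1`-form on a normed space. -/
def extForm (a : E → E →L[ℝ] ℝ) (p : E) : E →L[ℝ] E →L[ℝ] ℝ :=
  fderiv ℝ a p - (fderiv ℝ a p).flip

/-- The Lie derivative of a `(0,2)`-tensor field on a normed space. -/
def lieBilin (X : E → E) (h : E → E →L[ℝ] E →L[ℝ] ℝ) (p : E) : E →L[ℝ] E →L[ℝ] ℝ :=
  fderiv ℝ h p (X p) + (h p).bilinearComp (fderiv ℝ X p) (ContinuousLinearMap.id ℝ E)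
    + (h p).bilinearComp (ContinuousLinearMap.id ℝ E) (fderiv ℝ X p)

lemma lieForm_apply (X : E → E) (a : E → E →L[ℝ] ℝ) (p v : E) :
    lieForm X a p v = fderiv ℝ a p (X p) v + a p (fderiv ℝ X p v) := rfl

lemma extForm_apply (a : E → E →L[ℝ] ℝ) (p u v : E) :
    extForm a p u v = fderiv ℝ a p u v - fderiv ℝ a p v u := rfl

lemma lieBilin_apply (X : E → E) (h : E → E →L[ℝ] E →L[ℝ] ℝ) (p u v : E) :
    lieBilin X h p u v = fderiv ℝ h p (X p) u v + h p (fderiv ℝ X p u) v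
      + h p u (fderiv ℝ X p v) := rfl

variable {X Y Z : E → E} {a b : E → E →L[ℝ] ℝ} {h : E → E →L[ℝ] E →L[ℝ] ℝ} {p : E} {ψ : E → E}

lemma lieForm_congr (hX : X =ᶠ[𝓝 p] Y) (ha : a =ᶠ[𝓝 p] b) : lieForm X a p = lieForm Y b p := by
  simp only [lieForm, hX.fderiv_eq, ha.fderiv_eq, hX.eq_of_nhds, ha.eq_of_nhds]

/-- Chain and product rule for $a=\psi^*b$. The term with the second derivative of `ψ` is symmetric
in `u`, `v`, so it drops out of $da$; in $\mathcal L_Xa$ it is absorbed by differentiating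
$d\psi(X)=Y\circ\psi$. -/
lemma fderiv_form_pullback (hψ : ContDiffAt ℝ 2 ψ p) (hb : DifferentiableAt ℝ b (ψ p))
    (ha : ∀ᶠ y in 𝓝 p, a y = (b (ψ y)).comp (fderiv ℝ ψ y)) (u v : E) :
    fderiv ℝ a p u v = fderiv ℝ b (ψ p) (fderiv ℝ ψ p u) (fderiv ℝ ψ p v)
      + b (ψ p) (fderiv ℝ (fderiv ℝ ψ) p u v) := by
  have h1 : DifferentiableAt ℝ ψ p := hψ.differentiableAt (by norm_num)
  have h2 : DifferentiableAt ℝ (fderiv ℝ ψ) p :=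
    (hψ.fderiv_right (m := 1) (by norm_num)).differentiableAt (by norm_num)
  have h3 := ((hb.hasFDerivAt.comp p h1.hasFDerivAt).clm_comp h2.hasFDerivAt).congr_of_eventuallyEq
    ha
  rw [h3.fderiv]
  simp [add_comm]

/-- The exterior derivative commutes with pullbacks. -/
lemma extForm_pullback (hψ : ContDiffAt ℝ 2 ψ p) (hb : DifferentiableAt ℝ b (ψ p))
    (ha : ∀ᶠ y in 𝓝 p, a y = (b (ψ y)).comp (fderiv ℝ ψ y)) (u v : E) :
    extForm a p u v = extForm b (ψ p) (fderiv ℝ ψ p u) (fderiv ℝ ψ p v) := by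
  have hs : IsSymmSndFDerivAt ℝ ψ p := hψ.isSymmSndFDerivAt (by simp)
  rw [extForm_apply, extForm_apply, fderiv_form_pullback hψ hb ha, fderiv_form_pullback hψ hb ha,
    hs.eq u v]
  ring

/-- The Lie derivative of `1`-forms commutes with pullbacks. -/
lemma lieForm_pullback (hψ : ContDiffAt ℝ 2 ψ p) (hb : DifferentiableAt ℝ b (ψ p))
    (hX : DifferentiableAt ℝ X p) (hY : DifferentiableAt ℝ Y (ψ p))
    (ha : ∀ᶠ y in 𝓝 p, a y = (b (ψ y)).comp (fderiv ℝ ψ y))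
    (hXY : ∀ᶠ y in 𝓝 p, fderiv ℝ ψ y (X y) = Y (ψ y)) :
    lieForm X a p = (lieForm Y b (ψ p)).comp (fderiv ℝ ψ p) := by
  have hs : IsSymmSndFDerivAt ℝ ψ p := hψ.isSymmSndFDerivAt (by simp)
  have h1 : DifferentiableAt ℝ ψ p := hψ.differentiableAt (by norm_num)
  have h2 : DifferentiableAt ℝ (fderiv ℝ ψ) p :=
    (hψ.fderiv_right (m := 1) (by norm_num)).differentiableAt (by norm_num)
  ext v
  have h3 := (h2.hasFDerivAt.clm_apply hX.hasFDerivAt).congr_of_eventuallyEq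
    (hXY.mono fun y hy => hy.symm)
  have h4 := h3.unique (hY.hasFDerivAt.comp p h1.hasFDerivAt)
  have h5 := DFunLike.congr_fun h4 v
  simp only [add_apply, ContinuousLinearMap.comp_apply,
    ContinuousLinearMap.flip_apply] at h5
  rw [lieForm_apply, ContinuousLinearMap.comp_apply, lieForm_apply,
    fderiv_form_pullback hψ hb ha, ← h5, ha.self_of_nhds, hXY.self_of_nhds, hs.eq (X p) v]
  simp only [ContinuousLinearMap.comp_apply, map_add]
  ring

/-- If `L_X a` vanishes near `p` then so does `L_X da` at `p`. -/
lemma lieBilin_extForm (hX : ContDiffAt ℝ 2 X p) (ha : ContDiffAt ℝ 2 a p)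
    (hL : ∀ᶠ y in 𝓝 p, lieForm X a y = 0) : lieBilin X (extForm a) p = 0 := by
  have sX : IsSymmSndFDerivAt ℝ X p := hX.isSymmSndFDerivAt (by simp)
  have sa : IsSymmSndFDerivAt ℝ a p := ha.isSymmSndFDerivAt (by simp)
  have X1 : DifferentiableAt ℝ X p := hX.differentiableAt (by norm_num)
  have a1 : DifferentiableAt ℝ a p := ha.differentiableAt (by norm_num)
  have X2 : DifferentiableAt ℝ (fderiv ℝ X) p :=
    (hX.fderiv_right (m := 1) (by norm_num)).differentiableAt (by norm_num)
  have a2 : DifferentiableAt ℝ (fderiv ℝ a) p :=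
    (ha.fderiv_right (m := 1) (by norm_num)).differentiableAt (by norm_num)
  -- This is the derivative of $\mathcal L_Xa=0$ in the direction `u`, evaluated on `v`.
  -- Antisymmetrising it in `u`, `v` gives $\mathcal L_Xda$, by symmetry of the second derivatives
  -- of `a` and `X`.
  have key : ∀ u v, fderiv ℝ (fderiv ℝ a) p u (X p) v + fderiv ℝ a p (fderiv ℝ X p u) v
      + (fderiv ℝ a p u (fderiv ℝ X p v) + a p (fderiv ℝ (fderiv ℝ X) p u v)) = 0 := by
    intro u v
    have h1 := ((a2.hasFDerivAt.clm_apply X1.hasFDerivAt).add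
      (a1.hasFDerivAt.clm_comp X2.hasFDerivAt)).congr_of_eventuallyEq
      (f₁ := fun _ => 0) (hL.mono fun y hy => hy.symm)
    have h2 := h1.unique (hasFDerivAt_const _ _)
    have h3 := DFunLike.congr_fun (DFunLike.congr_fun h2 u) v
    simp at h3
    linarith
  let T : (E →L[ℝ] E →L[ℝ] ℝ) →L[ℝ] (E →L[ℝ] E →L[ℝ] ℝ) :=
    (ContinuousLinearMap.flipₗᵢ ℝ E E ℝ).toContinuousLinearEquiv.toContinuousLinearMap
  have hD := a2.hasFDerivAt.sub (T.hasFDerivAt.comp p a2.hasFDerivAt)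
  change HasFDerivAt (extForm a) _ p at hD
  ext u v
  have huv := key u v
  have hvu := key v u
  rw [lieBilin_apply, hD.fderiv]
  simp only [extForm_apply, sub_apply, ContinuousLinearMap.comp_apply,
    zero_apply]
  change fderiv ℝ (fderiv ℝ a) p (X p) u v - fderiv ℝ (fderiv ℝ a) p (X p) v u + _ + _ = 0
  rw [sa.eq (X p) u, sa.eq (X p) v]
  rw [sX.eq u v] at huv
  linarith

lemma lieForm_apply_field (ha : DifferentiableAt ℝ a p) (hZ : DifferentiableAt ℝ Z p) :
    lieForm X a p (Z p) = fderiv ℝ (fun y => a y (Z y)) p (X p)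
      - a p (VectorField.lieBracket ℝ X Z p) := by
  rw [lieForm_apply, (ha.hasFDerivAt.clm_apply hZ.hasFDerivAt).fderiv, VectorField.lieBracket]
  simp

/-- Cartan's formula $\iota_Xda=\mathcal L_Xa-d(a(X))$. -/
lemma extForm_apply_field (ha : DifferentiableAt ℝ a p) (hX : DifferentiableAt ℝ X p) :
    extForm a p (X p) = lieForm X a p - fderiv ℝ (fun y => a y (X y)) p := by
  ext v
  rw [extForm_apply, (ha.hasFDerivAt.clm_apply hX.hasFDerivAt).fderiv]
  simp [lieForm_apply]
  ring

/-- Cartan's formula for the exterior derivative of a `1`-form. -/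
lemma extForm_apply_fields (ha : DifferentiableAt ℝ a p) (hX : DifferentiableAt ℝ X p)
    (hZ : DifferentiableAt ℝ Z p) :
    extForm a p (X p) (Z p) = fderiv ℝ (fun y => a y (Z y)) p (X p)
      - fderiv ℝ (fun y => a y (X y)) p (Z p) - a p (VectorField.lieBracket ℝ X Z p) := by
  rw [extForm_apply_field ha hX, sub_apply, lieForm_apply_field ha hZ]
  ring

/-- Leibniz rule for the contraction of `h` with `Z`; it reduces a Lie derivative of a tensor to one
of a 1-form and a bracket. -/
lemma lieBilin_apply_field (hh : DifferentiableAt ℝ h p) (hZ : DifferentiableAt ℝ Z p) :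
    lieBilin X h p (Z p) = lieForm X (fun y => h y (Z y)) p
      - h p (VectorField.lieBracket ℝ X Z p) := by
  ext v
  rw [lieBilin_apply, sub_apply, lieForm_apply,
    (hh.hasFDerivAt.clm_apply hZ.hasFDerivAt).fderiv, VectorField.lieBracket]
  simp
  ring

/-- If `L_X ω = 0` for `ω(u, v) = h(J u, v)` with `J³ = -J` and `J` skew for `h`, then the
restriction of `L_X h` to the image of `J` is anti-invariant under `J`. -/
lemma lieBilin_anti_invariant {J : E → E →L[ℝ] E} (hh : DifferentiableAt ℝ h p)
    (hJ : DifferentiableAt ℝ J p)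
    (hskew : ∀ u v, h p (J p u) v = -h p u (J p v))
    (hcube : ∀ᶠ y in 𝓝 p, ∀ u, J y (J y (J y u)) = -J y u)
    (hL : lieBilin X (fun y => (h y).comp (J y)) p = 0) (u v : E) :
    lieBilin X h p (J p (J p u)) (J p (J p v)) = -lieBilin X h p (J p u) (J p v) := by
  -- `A` is $\mathcal L_XJ$. By the Leibniz rule, $\mathcal L_X\omega=0$ says $(\mathcal
  -- L_Xh)(Ju,v)=-h(Au,v)$.
  set A : E →L[ℝ] E := fderiv ℝ J p (X p) - (fderiv ℝ X p).comp (J p) + (J p).comp (fderiv ℝ X p)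
    with hA
  have hW : ∀ u v, lieBilin X h p (J p u) v = -h p (A u) v := by
    intro u v
    have h1 := DFunLike.congr_fun (DFunLike.congr_fun hL u) v
    rw [lieBilin_apply, (hh.hasFDerivAt.clm_comp hJ.hasFDerivAt).fderiv] at h1
    rw [lieBilin_apply, hA]
    simp at h1 ⊢
    linarith
  -- The Lie derivative of $J^3=-J$.
  have hA3 : ∀ u, A (J p (J p u)) + J p (A (J p u)) + J p (J p (A u)) = -A u := by
    intro u
    have h1 : HasFDerivAt (fun y => (J y).comp ((J y).comp (J y))) _ p :=
      hJ.hasFDerivAt.clm_comp (hJ.hasFDerivAt.clm_comp hJ.hasFDerivAt)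
    have h2 := h1.congr_of_eventuallyEq (f₁ := fun y => - J y)
      (hcube.mono fun y hy => by ext w; simpa using (hy w).symm)
    have h3 := h2.unique hJ.hasFDerivAt.neg
    have h4 := DFunLike.congr_fun (DFunLike.congr_fun h3 (X p)) u
    have h5 := hcube.self_of_nhds u
    have h6 := hcube.self_of_nhds (fderiv ℝ X p u)
    simp at h4
    have h7 := congrArg (fderiv ℝ X p) h5
    rw [map_neg] at h7
    simp only [hA, add_apply, sub_apply,
      ContinuousLinearMap.comp_apply, map_add, map_sub, h6, h7]
    rw [← sub_eq_zero] at h4 ⊢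
    rw [← h4]
    abel
  -- `J` is self-adjoint for $\mathcal L_Xh$ on its image. From `hW` and $J^3=-J$,
  -- $h(AJ^2u,v)=-h(Au,v)$, so `hA3` leaves $h(JAJu+J^2Au,v)=0$; skewness moves the outer `J`s to
  -- `v`. Replacing `u` by `J u` then gives the anti-invariance.
  have h1 : ∀ u v, lieBilin X h p (J p (J p u)) (J p v) = lieBilin X h p (J p u) (J p (J p v)) := by
    intro u v
    have e1 := hskew (A (J p u)) v
    have e2 := congrArg (fun w => h p w v) (hA3 u)
    have e3 := hskew (J p (A u)) v
    have e4 := hskew (A u) (J p v)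
    have e5 := hW (J p (J p u)) v
    have e6 := hW u v
    rw [hcube.self_of_nhds u] at e5
    simp only [map_add, map_neg, add_apply, neg_apply]
      at e2 e5
    rw [hW, hW]
    linarith
  have h2 := h1 (J p u) v
  rw [hcube.self_of_nhds u] at h2
  simp only [map_neg, neg_apply] at h2
  exact h2.symm

end FlatCalculus

/-! ### Tensor fields read in a preferred chart. -/

section Charts

variable {E : Type*} [NormedAddCommGroup E] [NormedSpace ℝ E]
  {M : Type*} [TopologicalSpace M] [ChartedSpace E M]

/-- An endomorphism field read in the preferred chart at `x`. -/
def chartEnd (x : M) (J : (x : M) → TangentSpace 𝓘(ℝ, E) x →L[ℝ] TangentSpace 𝓘(ℝ, E) x)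
    (y : E) : E →L[ℝ] E :=
  (chartInvDeriv (M := M) x y).inverse.comp
    ((J ((extChartAt 𝓘(ℝ, E) x).symm y)).comp (chartInvDeriv x y))

lemma lieDerivForm_eq (X : (x : M) → TangentSpace 𝓘(ℝ, E) x)
    (α : (x : M) → TangentSpace 𝓘(ℝ, E) x →L[ℝ] ℝ) (x : M) :
    lieDerivForm X α x =
      (lieForm (chartField x X) (chartForm x α) (extChartAt 𝓘(ℝ, E) x x)).comp (chartDeriv x) := rfl

lemma extDerivForm_eq (α : (x : M) → TangentSpace 𝓘(ℝ, E) x →L[ℝ] ℝ) (x : M) :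
    extDerivForm α x =
      pullbackBilin (extForm (chartForm x α) (extChartAt 𝓘(ℝ, E) x x)) (chartDeriv x) := rfl

lemma lieDerivBilin_eq (X : (x : M) → TangentSpace 𝓘(ℝ, E) x)
    (h : (x : M) → TangentSpace 𝓘(ℝ, E) x →L[ℝ] TangentSpace 𝓘(ℝ, E) x →L[ℝ] ℝ) (x : M) :
    lieDerivBilin X h x =
      pullbackBilin (lieBilin (chartField x X) (chartBilin x h) (extChartAt 𝓘(ℝ, E) x x))
        (chartDeriv x) := rfl

variable [IsManifold 𝓘(ℝ, E) ∞ M] {x : M} {y : E}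

lemma isInvertible_mfderiv_extChartAt_symm (hy : y ∈ (extChartAt 𝓘(ℝ, E) x).target) :
    (mfderiv 𝓘(ℝ, E) 𝓘(ℝ, E) (extChartAt 𝓘(ℝ, E) x).symm y).IsInvertible := by
  have := isInvertible_mfderivWithin_extChartAt_symm (I := 𝓘(ℝ, E)) (x := x) hy
  rw [modelWithCornersSelf_coe, Set.range_id, mfderivWithin_univ] at this
  exact this

lemma isInvertible_chartInvDeriv (hy : y ∈ (extChartAt 𝓘(ℝ, E) x).target) :
    (chartInvDeriv (M := M) x y).IsInvertible :=
  isInvertible_mfderiv_extChartAt_symm hy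

lemma chartInvDeriv_comp_mfderiv {z : M} (hz : z ∈ (extChartAt 𝓘(ℝ, E) x).source)
    (u : TangentSpace 𝓘(ℝ, E) z) :
    chartInvDeriv x (extChartAt 𝓘(ℝ, E) x z)
      (mfderiv 𝓘(ℝ, E) 𝓘(ℝ, E) (extChartAt 𝓘(ℝ, E) x) z u) = u := by
  have := mfderivWithin_extChartAt_symm_comp_mfderiv_extChartAt' (I := 𝓘(ℝ, E)) (x := x) hz
  rw [modelWithCornersSelf_coe, Set.range_id, mfderivWithin_univ] at this
  exact DFunLike.congr_fun this u

lemma chartInvDeriv_chartField (hy : y ∈ (extChartAt 𝓘(ℝ, E) x).target)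
    (X : (x : M) → TangentSpace 𝓘(ℝ, E) x) :
    chartInvDeriv x y (chartField x X y) = X ((extChartAt 𝓘(ℝ, E) x).symm y) :=
  (isInvertible_chartInvDeriv hy).self_apply_inverse _

lemma chartInvDeriv_chartEnd (hy : y ∈ (extChartAt 𝓘(ℝ, E) x).target)
    (J : (x : M) → TangentSpace 𝓘(ℝ, E) x →L[ℝ] TangentSpace 𝓘(ℝ, E) x) (u : E) :
    chartInvDeriv x y (chartEnd x J y u) = J _ (chartInvDeriv x y u) :=
  (isInvertible_chartInvDeriv hy).self_apply_inverse _

lemma chartInvDeriv_injective (hy : y ∈ (extChartAt 𝓘(ℝ, E) x).target) :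
    Function.Injective (chartInvDeriv (M := M) x y) :=
  (isInvertible_chartInvDeriv hy).injective

lemma chartForm_chartField (hy : y ∈ (extChartAt 𝓘(ℝ, E) x).target)
    (α : (x : M) → TangentSpace 𝓘(ℝ, E) x →L[ℝ] ℝ) (X : (x : M) → TangentSpace 𝓘(ℝ, E) x) :
    chartForm x α y (chartField x X y) = α _ (X ((extChartAt 𝓘(ℝ, E) x).symm y)) := by
  change α _ (chartInvDeriv x y _) = _
  rw [chartInvDeriv_chartField hy]

omit [IsManifold 𝓘(ℝ, E) ∞ M] in
lemma chartBilin_apply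
    (h : (x : M) → TangentSpace 𝓘(ℝ, E) x →L[ℝ] TangentSpace 𝓘(ℝ, E) x →L[ℝ] ℝ) (u v : E) :
    chartBilin x h y u v = h _ (chartInvDeriv x y u) (chartInvDeriv x y v) := rfl

lemma chartForm_flat (hy : y ∈ (extChartAt 𝓘(ℝ, E) x).target)
    (h : (x : M) → TangentSpace 𝓘(ℝ, E) x →L[ℝ] TangentSpace 𝓘(ℝ, E) x →L[ℝ] ℝ)
    (X : (x : M) → TangentSpace 𝓘(ℝ, E) x) :
    chartForm x (flat h X) y = chartBilin x h y (chartField x X y) := by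
  ext v
  rw [chartBilin_apply, chartInvDeriv_chartField hy]
  rfl

lemma chartBilin_hermitianForm (hy : y ∈ (extChartAt 𝓘(ℝ, E) x).target)
    (h : (x : M) → TangentSpace 𝓘(ℝ, E) x →L[ℝ] TangentSpace 𝓘(ℝ, E) x →L[ℝ] ℝ)
    (J : (x : M) → TangentSpace 𝓘(ℝ, E) x →L[ℝ] TangentSpace 𝓘(ℝ, E) x) :
    chartBilin x (hermitianForm h J) y = (chartBilin x h y).comp (chartEnd x J y) := by
  ext u v
  rw [ContinuousLinearMap.comp_apply, chartBilin_apply, chartBilin_apply, chartInvDeriv_chartEnd hy]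
  rfl

lemma chartInvDeriv_chartDeriv (x : M) (u : TangentSpace 𝓘(ℝ, E) x) :
    chartInvDeriv x (extChartAt 𝓘(ℝ, E) x x) (chartDeriv x u) = u :=
  chartInvDeriv_comp_mfderiv (mem_extChartAt_source x) u

lemma chartDeriv_bijective (x : M) : Function.Bijective (chartDeriv (E := E) x) :=
  (isInvertible_mfderiv_extChartAt (I := 𝓘(ℝ, E)) (mem_extChartAt_source x)).bijective

omit [IsManifold 𝓘(ℝ, E) ∞ M] in
lemma eventually_mem_target {p : E} (hp : p ∈ (extChartAt 𝓘(ℝ, E) x).target) :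
    ∀ᶠ y in 𝓝 p, y ∈ (extChartAt 𝓘(ℝ, E) x).target :=
  (isOpen_extChartAt_target x).mem_nhds hp

/-- The value at `x` of a vector field is carried by `chartDeriv` to its chart expression. -/
lemma chartDeriv_apply (X : (x : M) → TangentSpace 𝓘(ℝ, E) x) (x : M) :
    chartDeriv (E := E) x (X x) = chartField x X (extChartAt 𝓘(ℝ, E) x x) := by
  apply chartInvDeriv_injective (M := M) (mem_extChartAt_target (I := 𝓘(ℝ, E)) x)
  rw [chartInvDeriv_chartField (mem_extChartAt_target x), extChartAt_to_inv]
  exact chartInvDeriv_chartDeriv x _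

lemma chartBilin_chartDeriv
    (h : (x : M) → TangentSpace 𝓘(ℝ, E) x →L[ℝ] TangentSpace 𝓘(ℝ, E) x →L[ℝ] ℝ) (x : M)
    (u v : TangentSpace 𝓘(ℝ, E) x) :
    chartBilin x h (extChartAt 𝓘(ℝ, E) x x) (chartDeriv x u) (chartDeriv x v) = h x u v := by
  -- The base point returned by the chart and its inverse equals `x` only propositionally. All
  -- tangent spaces being definitionally `E`, the transport is done with vectors typed in `E`.
  have : ∀ z : M, z = x → ∀ (u' v' : E),
      h z u' v' = h x u' v' := by rintro z rfl u' v'; rfl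
  rw [chartBilin_apply]
  refine (this _ (extChartAt_to_inv (I := 𝓘(ℝ, E)) x) _ _).trans ?_
  congr 1
  · exact congrArg _ (chartInvDeriv_chartDeriv x u)
  · exact chartInvDeriv_chartDeriv x v

lemma chartForm_chartDeriv (α : (x : M) → TangentSpace 𝓘(ℝ, E) x →L[ℝ] ℝ) (x : M)
    (v : TangentSpace 𝓘(ℝ, E) x) :
    chartForm x α (extChartAt 𝓘(ℝ, E) x x) (chartDeriv x v) = α x v := by
  have : ∀ z : M, z = x → ∀ (v' : E), α z v' = α x v' := by rintro z rfl v'; rfl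
  refine (this _ (extChartAt_to_inv (I := 𝓘(ℝ, E)) x) _).trans ?_
  exact congrArg _ (chartInvDeriv_chartDeriv x v)

lemma chartEnd_chartDeriv
    (J : (x : M) → TangentSpace 𝓘(ℝ, E) x →L[ℝ] TangentSpace 𝓘(ℝ, E) x) (x : M)
    (v : TangentSpace 𝓘(ℝ, E) x) :
    chartEnd x J (extChartAt 𝓘(ℝ, E) x x) (chartDeriv x v) = chartDeriv x (J x v) := by
  have : ∀ z : M, z = x → ∀ (v' : E), (J z v' : E) = J x v' := by rintro z rfl v'; rfl
  apply chartInvDeriv_injective (M := M) (mem_extChartAt_target (I := 𝓘(ℝ, E)) x)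
  rw [chartInvDeriv_chartEnd (mem_extChartAt_target x)]
  refine (this _ (extChartAt_to_inv (I := 𝓘(ℝ, E)) x) _).trans ?_
  refine Eq.trans ?_ (chartInvDeriv_chartDeriv x _).symm
  exact congrArg _ (chartInvDeriv_chartDeriv x v)

/-- The manifold bracket is the pullback, under the differential of the chart, of the bracket of the
chart expressions; `chartDeriv` undoes that pullback. -/
lemma chartDeriv_mlieBracket (X Y : (x : M) → TangentSpace 𝓘(ℝ, E) x) (x : M) :
    chartDeriv x (VectorField.mlieBracket 𝓘(ℝ, E) X Y x) =
      VectorField.lieBracket ℝ (chartField x X) (chartField x Y) (extChartAt 𝓘(ℝ, E) x x) := by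
  rw [← VectorField.mlieBracketWithin_univ, VectorField.mlieBracketWithin_apply]
  simp only [modelWithCornersSelf_coe, Set.range_id, VectorField.mpullbackWithin_univ,
    Set.preimage_univ, Set.inter_self]
  refine ((isInvertible_mfderiv_extChartAt (I := 𝓘(ℝ, E))
    (mem_extChartAt_source x)).self_apply_inverse _).trans ?_
  change VectorField.lieBracketWithin ℝ (chartField x X) (chartField x Y) Set.univ
    (extChartAt 𝓘(ℝ, E) x x) = _
  rw [VectorField.lieBracketWithin_univ]

end Charts

/-! ### Smoothness of chart expressions, and transition maps. -/

section Smoothness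

variable {E : Type*} [NormedAddCommGroup E] [NormedSpace ℝ E]
  {M : Type*} [TopologicalSpace M] [ChartedSpace E M] [IsManifold 𝓘(ℝ, E) ∞ M] {x : M} {y : E}

/-- A basis of `E` identifies $\mathrm{Hom}(E,F)$ with $F^d$, so smoothness can be tested on each
vector. -/
lemma contDiffAt_clm_of_apply [FiniteDimensional ℝ E] {F : Type*} [NormedAddCommGroup F]
    [NormedSpace ℝ F] {f : E → E →L[ℝ] F} {n : WithTop ℕ∞} {p : E}
    (hf : ∀ u, ContDiffAt ℝ n (fun y => f y u) p) : ContDiffAt ℝ n f p := by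
  simp only [← contDiffWithinAt_univ] at hf ⊢
  let d := Module.finrank ℝ E
  have hd : d = Module.finrank ℝ (Fin d → ℝ) := (Module.finrank_fin_fun ℝ).symm
  let e₁ := ContinuousLinearEquiv.ofFinrankEq hd
  let e₂ := (e₁.arrowCongr (1 : F ≃L[ℝ] F)).trans (ContinuousLinearEquiv.piRing (Fin d))
  rw [← id_comp f, ← e₂.symm_comp_self]
  exact e₂.symm.contDiff.comp_contDiffWithinAt
    (contDiffWithinAt_pi.mpr fun i => hf _)

lemma contMDiffAt_extChartAt_symm (hy : y ∈ (extChartAt 𝓘(ℝ, E) x).target) :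
    ContMDiffAt 𝓘(ℝ, E) 𝓘(ℝ, E) ∞ (extChartAt 𝓘(ℝ, E) x).symm y :=
  (contMDiffOn_extChartAt_symm x).contMDiffAt ((isOpen_extChartAt_target x).mem_nhds hy)

lemma contDiffAt_chartField_of_contMDiffAt [CompleteSpace E]
    {X : (x : M) → TangentSpace 𝓘(ℝ, E) x}
    (hy : y ∈ (extChartAt 𝓘(ℝ, E) x).target)
    (hX : ContMDiffAt 𝓘(ℝ, E) 𝓘(ℝ, E).tangent ∞
      (fun x => (⟨x, X x⟩ : TangentBundle 𝓘(ℝ, E) M)) ((extChartAt 𝓘(ℝ, E) x).symm y)) :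
    ContDiffAt ℝ ∞ (chartField x X) y := by
  have := ContMDiffAt.mpullback_vectorField_preimage hX (contMDiffAt_extChartAt_symm hy)
    (isInvertible_mfderiv_extChartAt_symm hy) (m := ∞) (n := ∞) (by simp)
  exact contMDiffAt_vectorSpace_iff_contDiffAt (V := chartField x X).1 this

lemma contDiffAt_chartField [CompleteSpace E] {X : (x : M) → TangentSpace 𝓘(ℝ, E) x} {U : Set M}
    (hX : IsSmoothFieldOn X U) (hU : IsOpen U)
    (hy : y ∈ (extChartAt 𝓘(ℝ, E) x).target) (hyU : (extChartAt 𝓘(ℝ, E) x).symm y ∈ U) :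
    ContDiffAt ℝ ∞ (chartField x X) y :=
  contDiffAt_chartField_of_contMDiffAt hy (hX.contMDiffAt (hU.mem_nhds hyU))

/-- The vector field with constant components `u` in the preferred chart at `x`. -/
def coordField (x : M) (u : E) : (z : M) → TangentSpace 𝓘(ℝ, E) z :=
  VectorField.mpullback 𝓘(ℝ, E) 𝓘(ℝ, E) (extChartAt 𝓘(ℝ, E) x) (fun _ => u)

lemma coordField_apply (hy : y ∈ (extChartAt 𝓘(ℝ, E) x).target) (u : E) :
    coordField x u ((extChartAt 𝓘(ℝ, E) x).symm y) = chartInvDeriv x y u := by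
  have h1 := (extChartAt 𝓘(ℝ, E) x).map_target hy
  apply (isInvertible_mfderiv_extChartAt (I := 𝓘(ℝ, E)) h1).injective
  refine ((isInvertible_mfderiv_extChartAt (I := 𝓘(ℝ, E)) h1).self_apply_inverse _).trans ?_
  have := mfderiv_extChartAt_comp_mfderivWithin_extChartAt_symm (I := 𝓘(ℝ, E)) (x := x) hy
  rw [modelWithCornersSelf_coe, Set.range_id, mfderivWithin_univ] at this
  exact (DFunLike.congr_fun this u).symm

lemma contMDiffAt_coordField [CompleteSpace E] {z : M}
    (hz : z ∈ (extChartAt 𝓘(ℝ, E) x).source) (u : E) :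
    ContMDiffAt 𝓘(ℝ, E) 𝓘(ℝ, E).tangent ∞
      (fun z => (⟨z, coordField x u z⟩ : TangentBundle 𝓘(ℝ, E) M)) z := by
  have hc : ContMDiffAt 𝓘(ℝ, E) 𝓘(ℝ, E).tangent ∞
      (fun y : E => (⟨y, u⟩ : TangentBundle 𝓘(ℝ, E) E)) (extChartAt 𝓘(ℝ, E) x z) :=
    contMDiffAt_vectorSpace_iff_contDiffAt.2 contDiffAt_const
  exact ContMDiffAt.mpullback_vectorField_preimage hc
    (contMDiffAt_extChartAt' (by simpa using hz))
    (isInvertible_mfderiv_extChartAt hz) (m := ∞) (n := ∞) (by simp)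

/-- The components of the chart expression are the values of `h` on coordinate fields, which are
smooth sections. -/
lemma contDiffAt_chartBilin [FiniteDimensional ℝ E]
    {h : (x : M) → TangentSpace 𝓘(ℝ, E) x →L[ℝ] TangentSpace 𝓘(ℝ, E) x →L[ℝ] ℝ}
    (hh : IsSmoothBilin h) (hy : y ∈ (extChartAt 𝓘(ℝ, E) x).target) :
    ContDiffAt ℝ ∞ (chartBilin x h) y := by
  have : CompleteSpace E := FiniteDimensional.complete ℝ E
  refine contDiffAt_clm_of_apply fun u => contDiffAt_clm_of_apply fun v => ?_
  have h1 := (extChartAt 𝓘(ℝ, E) x).map_target hy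
  have h2 := (hh ((extChartAt 𝓘(ℝ, E) x).symm y)).clm_bundle_apply₂
    (E₃ := Bundle.Trivial M ℝ)
    (contMDiffAt_coordField h1 u) (contMDiffAt_coordField h1 v)
  rw [Bundle.contMDiffAt_totalSpace] at h2
  have h3 := (h2.2.comp y (contMDiffAt_extChartAt_symm hy)).contDiffAt
  refine h3.congr_of_eventuallyEq ?_
  filter_upwards [eventually_mem_target hy] with z hz
  rw [chartBilin_apply, ← coordField_apply hz, ← coordField_apply hz]
  rfl

lemma contDiffAt_chartEnd [FiniteDimensional ℝ E]
    {J : (x : M) → TangentSpace 𝓘(ℝ, E) x →L[ℝ] TangentSpace 𝓘(ℝ, E) x}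
    (hJ : IsSmoothEnd J) (hy : y ∈ (extChartAt 𝓘(ℝ, E) x).target) :
    ContDiffAt ℝ ∞ (chartEnd x J) y := by
  have : CompleteSpace E := FiniteDimensional.complete ℝ E
  refine contDiffAt_clm_of_apply fun u => ?_
  have h1 := (extChartAt 𝓘(ℝ, E) x).map_target hy
  have h2 := (hJ ((extChartAt 𝓘(ℝ, E) x).symm y)).clm_bundle_apply (contMDiffAt_coordField h1 u)
  refine (contDiffAt_chartField_of_contMDiffAt hy h2).congr_of_eventuallyEq ?_
  filter_upwards [eventually_mem_target hy] with z hz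
  apply chartInvDeriv_injective (M := M) hz
  rw [chartInvDeriv_chartEnd hz, chartInvDeriv_chartField hz, coordField_apply hz]

lemma contDiffAt_chartForm_flat [FiniteDimensional ℝ E]
    {h : (x : M) → TangentSpace 𝓘(ℝ, E) x →L[ℝ] TangentSpace 𝓘(ℝ, E) x →L[ℝ] ℝ}
    {X : (x : M) → TangentSpace 𝓘(ℝ, E) x}
    (hh : IsSmoothBilin h) (hX : IsSmoothFieldOn X Set.univ)
    (hy : y ∈ (extChartAt 𝓘(ℝ, E) x).target) :
    ContDiffAt ℝ ∞ (chartForm x (flat h X)) y := by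
  have : CompleteSpace E := FiniteDimensional.complete ℝ E
  refine ((contDiffAt_chartBilin hh hy).clm_apply
    (contDiffAt_chartField hX isOpen_univ hy trivial)).congr_of_eventuallyEq ?_
  filter_upwards [eventually_mem_target hy] with z hz
  exact chartForm_flat hz h X

/-- The transition map from the preferred chart at `z` to the preferred chart at `x`. -/
def transition (x z : M) (y : E) : E := extChartAt 𝓘(ℝ, E) x ((extChartAt 𝓘(ℝ, E) z).symm y)

lemma eventually_transition {z : M} (hy : y ∈ (extChartAt 𝓘(ℝ, E) z).target)
    (hyx : (extChartAt 𝓘(ℝ, E) z).symm y ∈ (extChartAt 𝓘(ℝ, E) x).source) :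
    ∀ᶠ w in 𝓝 y, w ∈ (extChartAt 𝓘(ℝ, E) z).target ∧
      (extChartAt 𝓘(ℝ, E) z).symm w ∈ (extChartAt 𝓘(ℝ, E) x).source :=
  (eventually_mem_target hy).and ((contMDiffAt_extChartAt_symm hy).continuousAt.preimage_mem_nhds
    ((isOpen_extChartAt_source x).mem_nhds hyx))

lemma contDiffAt_transition {z : M} (hy : y ∈ (extChartAt 𝓘(ℝ, E) z).target)
    (hyx : (extChartAt 𝓘(ℝ, E) z).symm y ∈ (extChartAt 𝓘(ℝ, E) x).source) :
    ContDiffAt ℝ ∞ (transition x z) y :=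
  (ContMDiffAt.comp y (contMDiffAt_extChartAt' (by simpa using hyx))
    (contMDiffAt_extChartAt_symm hy)).contDiffAt

/-- Chain rule for $\psi=\varphi_x\circ\varphi_z^{-1}$, with $d\varphi_x$ cancelled by its inverse.
-/
lemma chartInvDeriv_transition {z : M} (hy : y ∈ (extChartAt 𝓘(ℝ, E) z).target)
    (hyx : (extChartAt 𝓘(ℝ, E) z).symm y ∈ (extChartAt 𝓘(ℝ, E) x).source) (u : E) :
    chartInvDeriv x (transition x z y) (fderiv ℝ (transition x z) y u) = chartInvDeriv z y u := by
  have h1 : MDifferentiableAt 𝓘(ℝ, E) 𝓘(ℝ, E) (extChartAt 𝓘(ℝ, E) z).symm y :=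
    (contMDiffAt_extChartAt_symm hy).mdifferentiableAt (by simp)
  have h2 : MDifferentiableAt 𝓘(ℝ, E) 𝓘(ℝ, E) (extChartAt 𝓘(ℝ, E) x)
      ((extChartAt 𝓘(ℝ, E) z).symm y) := mdifferentiableAt_extChartAt (by simpa using hyx)
  have h3 := mfderiv_comp y h2 h1
  rw [← mfderiv_eq_fderiv]
  refine Eq.trans ?_ (chartInvDeriv_comp_mfderiv hyx (chartInvDeriv z y u))
  exact congrArg (chartInvDeriv x (transition x z y)) (DFunLike.congr_fun h3 u)

end Smoothness

/-! ### Independence of the chart for $\mathcal L_X\alpha$ and $d\alpha$. -/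

section ChartIndependence

variable {E : Type*} [NormedAddCommGroup E] [NormedSpace ℝ E]
  {M : Type*} [TopologicalSpace M] [ChartedSpace E M] [IsManifold 𝓘(ℝ, E) ∞ M] {x : M} {y : E}

lemma two_le_infty : (2 : WithTop ℕ∞) ≤ ∞ := WithTop.coe_le_coe.2 le_top

lemma mfderiv_extChartAt_chartInvDeriv (hy : y ∈ (extChartAt 𝓘(ℝ, E) x).target) (u : E) :
    mfderiv 𝓘(ℝ, E) 𝓘(ℝ, E) (extChartAt 𝓘(ℝ, E) x) ((extChartAt 𝓘(ℝ, E) x).symm y)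
      (chartInvDeriv x y u) = u := by
  have := mfderiv_extChartAt_comp_mfderivWithin_extChartAt_symm (I := 𝓘(ℝ, E)) (x := x) hy
  rw [modelWithCornersSelf_coe, Set.range_id, mfderivWithin_univ] at this
  exact DFunLike.congr_fun this u

lemma fderiv_transition_chartDeriv {z : M} (hz : z ∈ (extChartAt 𝓘(ℝ, E) x).source)
    (u : TangentSpace 𝓘(ℝ, E) z) :
    fderiv ℝ (transition x z) (extChartAt 𝓘(ℝ, E) z z) (chartDeriv z u) =
      mfderiv 𝓘(ℝ, E) 𝓘(ℝ, E) (extChartAt 𝓘(ℝ, E) x) z u := by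
  have hψ : transition x z (extChartAt 𝓘(ℝ, E) z z) = extChartAt 𝓘(ℝ, E) x z := by
    simp [transition]
  have hz' : (extChartAt 𝓘(ℝ, E) z).symm (extChartAt 𝓘(ℝ, E) z z) ∈
      (extChartAt 𝓘(ℝ, E) x).source := by rwa [extChartAt_to_inv]
  have h1 := chartInvDeriv_transition (mem_extChartAt_target z) hz' (chartDeriv z u)
  apply chartInvDeriv_injective ((extChartAt 𝓘(ℝ, E) x).map_source hz)
  rw [chartInvDeriv_comp_mfderiv hz]
  have : ∀ y : E, y = extChartAt 𝓘(ℝ, E) x z → ∀ w : E,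
    (chartInvDeriv x y w : E) = chartInvDeriv x (extChartAt 𝓘(ℝ, E) x z) w := by
    rintro y rfl w; rfl
  exact (this _ hψ _).symm.trans (h1.trans (chartInvDeriv_chartDeriv z u))

section Relations

variable {z : M} (hy : y ∈ (extChartAt 𝓘(ℝ, E) z).target)
  (hyx : (extChartAt 𝓘(ℝ, E) z).symm y ∈ (extChartAt 𝓘(ℝ, E) x).source)
include hy hyx

lemma chartForm_transition (α : (x : M) → TangentSpace 𝓘(ℝ, E) x →L[ℝ] ℝ) :
    chartForm z α y = (chartForm x α (transition x z y)).comp (fderiv ℝ (transition x z) y) := by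
  have : ∀ z' z : M, z' = z → ∀ (v' : E), α z' v' = α z v' := by rintro _ _ rfl v'; rfl
  ext u
  change α _ (chartInvDeriv z y u) = α _ (chartInvDeriv x (transition x z y)
    (fderiv ℝ (transition x z) y u))
  rw [chartInvDeriv_transition hy hyx]
  exact this _ _ ((extChartAt 𝓘(ℝ, E) x).left_inv hyx).symm _

lemma chartField_transition (X : (x : M) → TangentSpace 𝓘(ℝ, E) x) :
    fderiv ℝ (transition x z) y (chartField z X y) = chartField x X (transition x z y) := by
  have : ∀ z' z : M, z' = z → (X z' : E) = X z := by rintro _ _ rfl; rfl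
  have ht : transition x z y ∈ (extChartAt 𝓘(ℝ, E) x).target :=
    (extChartAt 𝓘(ℝ, E) x).map_source hyx
  apply chartInvDeriv_injective (M := M) ht
  rw [chartInvDeriv_transition hy hyx, chartInvDeriv_chartField hy, chartInvDeriv_chartField ht]
  exact this _ _ ((extChartAt 𝓘(ℝ, E) x).left_inv hyx).symm

end Relations

/-- The Lie derivative of a `1`-form may be computed in any preferred chart. -/
lemma lieDerivForm_apply_chart {z : M} (hz : z ∈ (extChartAt 𝓘(ℝ, E) x).source)
    {X : (x : M) → TangentSpace 𝓘(ℝ, E) x} {α : (x : M) → TangentSpace 𝓘(ℝ, E) x →L[ℝ] ℝ}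
    (hXz : DifferentiableAt ℝ (chartField z X) (extChartAt 𝓘(ℝ, E) z z))
    (hX : DifferentiableAt ℝ (chartField x X) (extChartAt 𝓘(ℝ, E) x z))
    (hα : DifferentiableAt ℝ (chartForm x α) (extChartAt 𝓘(ℝ, E) x z))
    (u : TangentSpace 𝓘(ℝ, E) z) :
    lieDerivForm X α z u = lieForm (chartField x X) (chartForm x α) (extChartAt 𝓘(ℝ, E) x z)
      (mfderiv 𝓘(ℝ, E) 𝓘(ℝ, E) (extChartAt 𝓘(ℝ, E) x) z u) := by
  have hψ : transition x z (extChartAt 𝓘(ℝ, E) z z) = extChartAt 𝓘(ℝ, E) x z := by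
    simp [transition]
  have hz' : (extChartAt 𝓘(ℝ, E) z).symm (extChartAt 𝓘(ℝ, E) z z) ∈
      (extChartAt 𝓘(ℝ, E) x).source := by rwa [extChartAt_to_inv]
  have hev := eventually_transition (mem_extChartAt_target z) hz'
  have h := lieForm_pullback (X := chartField z X) (Y := chartField x X)
    (a := chartForm z α) (b := chartForm x α)
    ((contDiffAt_transition (mem_extChartAt_target z) hz').of_le two_le_infty)
    (by rwa [hψ]) hXz (by rwa [hψ])
    (hev.mono fun w hw => chartForm_transition hw.1 hw.2 α)
    (hev.mono fun w hw => chartField_transition hw.1 hw.2 X)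
  rw [lieDerivForm_eq, h, hψ, ContinuousLinearMap.comp_apply, ContinuousLinearMap.comp_apply]
  exact congrArg _ (fderiv_transition_chartDeriv hz u)

/-- The exterior derivative of a `1`-form may be computed in any preferred chart. -/
lemma extDerivForm_apply_chart {z : M} (hz : z ∈ (extChartAt 𝓘(ℝ, E) x).source)
    {α : (x : M) → TangentSpace 𝓘(ℝ, E) x →L[ℝ] ℝ}
    (hα : DifferentiableAt ℝ (chartForm x α) (extChartAt 𝓘(ℝ, E) x z))
    (u v : TangentSpace 𝓘(ℝ, E) z) :
    extDerivForm α z u v = extForm (chartForm x α) (extChartAt 𝓘(ℝ, E) x z)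
      (mfderiv 𝓘(ℝ, E) 𝓘(ℝ, E) (extChartAt 𝓘(ℝ, E) x) z u)
      (mfderiv 𝓘(ℝ, E) 𝓘(ℝ, E) (extChartAt 𝓘(ℝ, E) x) z v) := by
  have hψ : transition x z (extChartAt 𝓘(ℝ, E) z z) = extChartAt 𝓘(ℝ, E) x z := by
    simp [transition]
  have hz' : (extChartAt 𝓘(ℝ, E) z).symm (extChartAt 𝓘(ℝ, E) z z) ∈
      (extChartAt 𝓘(ℝ, E) x).source := by rwa [extChartAt_to_inv]
  have hev := eventually_transition (mem_extChartAt_target z) hz'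
  have h := extForm_pullback (a := chartForm z α) (b := chartForm x α)
    ((contDiffAt_transition (mem_extChartAt_target z) hz').of_le two_le_infty)
    (by rwa [hψ]) (hev.mono fun w hw => chartForm_transition hw.1 hw.2 α)
    (chartDeriv z u) (chartDeriv z v)
  rw [hψ, fderiv_transition_chartDeriv hz, fderiv_transition_chartDeriv hz] at h
  exact h

/-- The value of $d\alpha$ at each nearby point is defined in that point's own chart; chart
independence reads all of them in the chart at `x`, so that $d\alpha$ can be differentiated there.
-/
lemma chartBilin_extDerivForm (hy : y ∈ (extChartAt 𝓘(ℝ, E) x).target)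
    {α : (x : M) → TangentSpace 𝓘(ℝ, E) x →L[ℝ] ℝ}
    (hα : DifferentiableAt ℝ (chartForm x α) y) :
    chartBilin x (extDerivForm α) y = extForm (chartForm x α) y := by
  ext u v
  rw [chartBilin_apply, extDerivForm_apply_chart ((extChartAt 𝓘(ℝ, E) x).map_target hy)
    (by rwa [(extChartAt 𝓘(ℝ, E) x).right_inv hy]), (extChartAt 𝓘(ℝ, E) x).right_inv hy]
  congr 1
  · exact congrArg _ (mfderiv_extChartAt_chartInvDeriv hy u)
  · exact mfderiv_extChartAt_chartInvDeriv hy v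

lemma lieForm_chart_eq_zero (hy : y ∈ (extChartAt 𝓘(ℝ, E) x).target)
    {X : (x : M) → TangentSpace 𝓘(ℝ, E) x} {α : (x : M) → TangentSpace 𝓘(ℝ, E) x →L[ℝ] ℝ}
    (hXz : ∀ z, DifferentiableAt ℝ (chartField z X) (extChartAt 𝓘(ℝ, E) z z))
    (hX : DifferentiableAt ℝ (chartField x X) y)
    (hα : DifferentiableAt ℝ (chartForm x α) y) (hL : ∀ z, lieDerivForm X α z = 0) :
    lieForm (chartField x X) (chartForm x α) y = 0 := by
  ext u
  have h := lieDerivForm_apply_chart ((extChartAt 𝓘(ℝ, E) x).map_target hy) (hXz _)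
    (by rwa [(extChartAt 𝓘(ℝ, E) x).right_inv hy])
    (by rwa [(extChartAt 𝓘(ℝ, E) x).right_inv hy]) (chartInvDeriv x y u)
  rw [hL, (extChartAt 𝓘(ℝ, E) x).right_inv hy] at h
  refine Eq.trans ?_ h.symm
  exact congrArg _ (mfderiv_extChartAt_chartInvDeriv hy u).symm

end ChartIndependence

section FlatSymmetric

variable {E : Type*} [NormedAddCommGroup E] [NormedSpace ℝ E]

lemma lieBilin_symm {X : E → E} {h : E → E →L[ℝ] E →L[ℝ] ℝ} {p : E}
    (hh : DifferentiableAt ℝ h p) (hs : ∀ᶠ y in 𝓝 p, ∀ u v, h y u v = h y v u) (u v : E) :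
    lieBilin X h p u v = lieBilin X h p v u := by
  have key : ∀ w u v, fderiv ℝ h p w u v = fderiv ℝ (fun y => h y u v) p w := by
    intro w u v
    rw [((hh.hasFDerivAt.clm_apply (hasFDerivAt_const u p)).clm_apply (hasFDerivAt_const v p)).fderiv]
    simp
  have h1 : (fun y => h y u v) =ᶠ[𝓝 p] fun y => h y v u := hs.mono fun y hy => hy u v
  rw [lieBilin_apply, lieBilin_apply, key, key, h1.fderiv_eq, hs.self_of_nhds _ v,
    hs.self_of_nhds u]
  ring

end FlatSymmetric

/-! ### Cartan calculus transferred to the manifold. -/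

section ManifoldCalculus

variable {E : Type*} [NormedAddCommGroup E] [NormedSpace ℝ E]
  {M : Type*} [TopologicalSpace M] [ChartedSpace E M] [IsManifold 𝓘(ℝ, E) ∞ M] {x : M} {U : Set M}
  {X Y Z : (x : M) → TangentSpace 𝓘(ℝ, E) x} {α : (x : M) → TangentSpace 𝓘(ℝ, E) x →L[ℝ] ℝ}
  {h : (x : M) → TangentSpace 𝓘(ℝ, E) x →L[ℝ] TangentSpace 𝓘(ℝ, E) x →L[ℝ] ℝ}
  {J : (x : M) → TangentSpace 𝓘(ℝ, E) x →L[ℝ] TangentSpace 𝓘(ℝ, E) x} {c d : ℝ}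

lemma fderiv_chart_pairing_eq_zero (hU : IsOpen U) (hx : x ∈ U) (hc : ∀ z ∈ U, α z (X z) = c) :
    fderiv ℝ (fun y => chartForm x α y (chartField x X y)) (extChartAt 𝓘(ℝ, E) x x) = 0 := by
  have h1 : (fun y => chartForm x α y (chartField x X y)) =ᶠ[𝓝 (extChartAt 𝓘(ℝ, E) x x)]
      fun _ => c := by
    filter_upwards [eventually_mem_target (mem_extChartAt_target (I := 𝓘(ℝ, E)) x),
      (contMDiffAt_extChartAt_symm (mem_extChartAt_target x)).continuousAt.preimage_mem_nhds
        (hU.mem_nhds (by rwa [extChartAt_to_inv]))] with y hy hyU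
    rw [chartForm_chartField hy]
    exact hc _ hyU
  rw [h1.fderiv_eq]
  simp

/-- When both pairings are constant, only the bracket term of $d\alpha(X,Y)$ survives. -/
lemma extDerivForm_apply_of_pairing_const (hU : IsOpen U) (hx : x ∈ U)
    (hα : DifferentiableAt ℝ (chartForm x α) (extChartAt 𝓘(ℝ, E) x x))
    (hX : DifferentiableAt ℝ (chartField x X) (extChartAt 𝓘(ℝ, E) x x))
    (hY : DifferentiableAt ℝ (chartField x Y) (extChartAt 𝓘(ℝ, E) x x))
    (hc : ∀ z ∈ U, α z (X z) = c) (hd : ∀ z ∈ U, α z (Y z) = d) :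
    extDerivForm α x (X x) (Y x) = -α x (VectorField.mlieBracket 𝓘(ℝ, E) X Y x) := by
  rw [extDerivForm_eq]
  change extForm _ _ (chartDeriv x (X x)) (chartDeriv x (Y x)) = _
  rw [chartDeriv_apply, chartDeriv_apply, extForm_apply_fields hα hX hY,
    fderiv_chart_pairing_eq_zero hU hx hc, fderiv_chart_pairing_eq_zero hU hx hd,
    ← chartDeriv_mlieBracket, chartForm_chartDeriv]
  simp

lemma extDerivForm_apply_eq_lieDerivForm
    (hα : DifferentiableAt ℝ (chartForm x α) (extChartAt 𝓘(ℝ, E) x x))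
    (hX : DifferentiableAt ℝ (chartField x X) (extChartAt 𝓘(ℝ, E) x x))
    (hc : ∀ z, α z (X z) = c) :
    extDerivForm α x (X x) = lieDerivForm X α x := by
  ext v
  rw [extDerivForm_eq]
  change extForm _ _ (chartDeriv x (X x)) (chartDeriv x v) = _
  rw [chartDeriv_apply, extForm_apply_field hα hX,
    fderiv_chart_pairing_eq_zero isOpen_univ trivial fun z _ => hc z, sub_zero]
  rfl

lemma lieDerivForm_apply_of_pairing_const
    (hα : DifferentiableAt ℝ (chartForm x α) (extChartAt 𝓘(ℝ, E) x x))
    (hZ : DifferentiableAt ℝ (chartField x Z) (extChartAt 𝓘(ℝ, E) x x))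
    (hc : ∀ z, α z (Z z) = c) :
    lieDerivForm X α x (Z x) = -α x (VectorField.mlieBracket 𝓘(ℝ, E) X Z x) := by
  rw [lieDerivForm_eq]
  change lieForm _ _ _ (chartDeriv x (Z x)) = _
  rw [chartDeriv_apply, lieForm_apply_field hα hZ,
    fderiv_chart_pairing_eq_zero isOpen_univ trivial fun z _ => hc z,
    ← chartDeriv_mlieBracket, chartForm_chartDeriv]
  simp

lemma pullbackBilin_apply {V W : Type*} [AddCommGroup V] [Module ℝ V] [TopologicalSpace V]
    [AddCommGroup W] [Module ℝ W] [TopologicalSpace W] (b : V →L[ℝ] V →L[ℝ] ℝ) (A : W →L[ℝ] V)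
    (u v : W) : pullbackBilin b A u v = b (A u) (A v) := rfl

omit [IsManifold 𝓘(ℝ, E) ∞ M] in
lemma lieDerivBilin_apply (u v : TangentSpace 𝓘(ℝ, E) x) :
    lieDerivBilin X h x u v =
      lieBilin (chartField x X) (chartBilin x h) (extChartAt 𝓘(ℝ, E) x x)
        (chartDeriv x u) (chartDeriv x v) := by
  rw [lieDerivBilin_eq, pullbackBilin_apply]

lemma lieDerivBilin_apply_field
    (hh : DifferentiableAt ℝ (chartBilin x h) (extChartAt 𝓘(ℝ, E) x x))
    (hZ : DifferentiableAt ℝ (chartField x Z) (extChartAt 𝓘(ℝ, E) x x))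
    (v : TangentSpace 𝓘(ℝ, E) x) :
    lieDerivBilin X h x (Z x) v = lieDerivForm X (flat h Z) x v
      - h x (VectorField.mlieBracket 𝓘(ℝ, E) X Z x) v := by
  have e : lieForm (chartField x X) (fun y => chartBilin x h y (chartField x Z y))
      (extChartAt 𝓘(ℝ, E) x x) = lieForm (chartField x X) (chartForm x (flat h Z))
      (extChartAt 𝓘(ℝ, E) x x) := by
    refine lieForm_congr EventuallyEq.rfl ?_
    filter_upwards [eventually_mem_target (mem_extChartAt_target (I := 𝓘(ℝ, E)) x)] with y hy
    exact (chartForm_flat hy h Z).symm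
  rw [lieDerivBilin_apply, lieDerivForm_eq, ContinuousLinearMap.comp_apply, ← e,
    ← chartBilin_chartDeriv, chartDeriv_mlieBracket, chartDeriv_apply, lieBilin_apply_field hh hZ,
    sub_apply]

omit [IsManifold 𝓘(ℝ, E) ∞ M] in
lemma lieDerivBilin_symm
    (hh : DifferentiableAt ℝ (chartBilin x h) (extChartAt 𝓘(ℝ, E) x x))
    (hs : ∀ z u v, h z u v = h z v u) (u v : TangentSpace 𝓘(ℝ, E) x) :
    lieDerivBilin X h x u v = lieDerivBilin X h x v u := by
  have hs' : ∀ᶠ y in 𝓝 (extChartAt 𝓘(ℝ, E) x x), ∀ u v,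
      chartBilin x h y u v = chartBilin x h y v u :=
    Eventually.of_forall fun y u v => hs _ _ _
  rw [lieDerivBilin_apply, lieDerivBilin_apply, lieBilin_symm hh hs']

/-- If `L_X α = 0` then `L_X dα = 0`. -/
lemma lieDerivBilin_extDerivForm
    (hX : ∀ (z : M) (y : E), y ∈ (extChartAt 𝓘(ℝ, E) z).target → ContDiffAt ℝ ∞ (chartField z X) y)
    (hα : ∀ (z : M) (y : E), y ∈ (extChartAt 𝓘(ℝ, E) z).target → ContDiffAt ℝ ∞ (chartForm z α) y)
    (hL : ∀ z, lieDerivForm X α z = 0) (x : M) : lieDerivBilin X (extDerivForm α) x = 0 := by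
  have ht := mem_extChartAt_target (I := 𝓘(ℝ, E)) x
  have h1 : lieBilin (chartField x X) (chartBilin x (extDerivForm α)) (extChartAt 𝓘(ℝ, E) x x)
      = 0 := by
    have h2 : chartBilin x (extDerivForm α) =ᶠ[𝓝 (extChartAt 𝓘(ℝ, E) x x)]
        extForm (chartForm x α) := by
      filter_upwards [eventually_mem_target ht] with y hy
      exact chartBilin_extDerivForm hy ((hα x y hy).differentiableAt (by simp))
    have h3 := lieBilin_extForm ((hX x _ ht).of_le two_le_infty) ((hα x _ ht).of_le two_le_infty)
      (by
        filter_upwards [eventually_mem_target ht] with y hy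
        exact lieForm_chart_eq_zero hy
          (fun z => (hX z _ (mem_extChartAt_target z)).differentiableAt (by simp))
          ((hX x y hy).differentiableAt (by simp)) ((hα x y hy).differentiableAt (by simp)) hL)
    rwa [lieBilin, ← h2.fderiv_eq, ← h2.eq_of_nhds] at h3
  rw [lieDerivBilin_eq, h1]
  rfl

lemma differentiableAt_chartBilin_hermitianForm
    (hh : DifferentiableAt ℝ (chartBilin x h) (extChartAt 𝓘(ℝ, E) x x))
    (hJ : DifferentiableAt ℝ (chartEnd x J) (extChartAt 𝓘(ℝ, E) x x)) :
    DifferentiableAt ℝ (chartBilin x (hermitianForm h J)) (extChartAt 𝓘(ℝ, E) x x) := by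
  refine (hh.clm_comp hJ).congr_of_eventuallyEq ?_
  filter_upwards [eventually_mem_target (mem_extChartAt_target (I := 𝓘(ℝ, E)) x)] with y hy
  exact chartBilin_hermitianForm hy h J

lemma lieDerivBilin_anti_invariant
    (hh : DifferentiableAt ℝ (chartBilin x h) (extChartAt 𝓘(ℝ, E) x x))
    (hJ : DifferentiableAt ℝ (chartEnd x J) (extChartAt 𝓘(ℝ, E) x x))
    (hskew : ∀ z u v, h z (J z u) v = -h z u (J z v))
    (hcube : ∀ z u, J z (J z (J z u)) = -J z u)
    (hL : lieDerivBilin X (hermitianForm h J) x = 0) (u v : TangentSpace 𝓘(ℝ, E) x) :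
    lieDerivBilin X h x (J x (J x u)) (J x (J x v)) = -lieDerivBilin X h x (J x u) (J x v) := by
  have ht := mem_extChartAt_target (I := 𝓘(ℝ, E)) x
  have h2 : chartBilin x (hermitianForm h J) =ᶠ[𝓝 (extChartAt 𝓘(ℝ, E) x x)]
      fun y => (chartBilin x h y).comp (chartEnd x J y) := by
    filter_upwards [eventually_mem_target ht] with y hy
    exact chartBilin_hermitianForm hy h J
  have h3 : lieBilin (chartField x X) (fun y => (chartBilin x h y).comp (chartEnd x J y))
      (extChartAt 𝓘(ℝ, E) x x) = 0 := by
    rw [lieBilin, ← h2.fderiv_eq, ← h2.eq_of_nhds]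
    ext u v
    obtain ⟨u, rfl⟩ := (chartDeriv_bijective (E := E) x).2 u
    obtain ⟨v, rfl⟩ := (chartDeriv_bijective (E := E) x).2 v
    exact DFunLike.congr_fun (DFunLike.congr_fun hL u) v
  have h4 := lieBilin_anti_invariant hh hJ (fun u v => ?_) ?_ h3 (chartDeriv x u) (chartDeriv x v)
  · simp only [chartEnd_chartDeriv] at h4
    exact h4
  · rw [chartBilin_apply, chartBilin_apply, chartInvDeriv_chartEnd ht, chartInvDeriv_chartEnd ht]
    exact hskew _ _ _
  · filter_upwards [eventually_mem_target ht] with y hy u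
    apply chartInvDeriv_injective (M := M) hy
    rw [map_neg]
    simp only [chartInvDeriv_chartEnd hy]
    exact hcube _ _

end ManifoldCalculus

/-! ### Almost Fefferman-Robinson geometry: the screen, $\omega=d\sigma^*$, and $\mathcal L_\nu g$.
-/

section FeffermanRobinson

variable {E : Type*} [NormedAddCommGroup E] [NormedSpace ℝ E]
  {M : Type*} [TopologicalSpace M] [ChartedSpace E M] [IsManifold 𝓘(ℝ, E) ∞ M] {m : ℕ}
  {g : (x : M) → TangentSpace 𝓘(ℝ, E) x →L[ℝ] TangentSpace 𝓘(ℝ, E) x →L[ℝ] ℝ}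
  {R Rs : (x : M) → Submodule ℝ (TangentSpace 𝓘(ℝ, E) x)}
  {ν νs : (x : M) → TangentSpace 𝓘(ℝ, E) x}
  {J : (x : M) → TangentSpace 𝓘(ℝ, E) x →L[ℝ] TangentSpace 𝓘(ℝ, E) x}

lemma IsLorentzian.eq_zero (hg : IsLorentzian m g) {x : M} {u : TangentSpace 𝓘(ℝ, E) x}
    (hu : ∀ v, g x u v = 0) : u = 0 := by
  obtain ⟨b, hb⟩ := hg.signature x
  apply b.ext_elem
  intro j
  have h1 := hu (b j)
  rw [← b.sum_repr u] at h1
  simp only [map_sum, map_smul, sum_apply, smul_apply, hb, smul_eq_mul, mul_ite, mul_zero,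
    Finset.sum_ite_eq', Finset.mem_univ, if_true] at h1
  rw [map_zero, Finsupp.zero_apply]
  split_ifs at h1 <;> linarith

lemma IsNullLineSubbundle.eq_span {L : (x : M) → Submodule ℝ (TangentSpace 𝓘(ℝ, E) x)}
    (hL : IsNullLineSubbundle g L) {x : M} {u : TangentSpace 𝓘(ℝ, E) x} (hu : u ∈ L x)
    (hu0 : u ≠ 0) : L x = Submodule.span ℝ {u} := by
  obtain ⟨U, X, -, hx, -, hX⟩ := hL.line x
  obtain ⟨-, hs⟩ := hX x hx
  rw [hs, Submodule.mem_span_singleton] at hu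
  obtain ⟨c, rfl⟩ := hu
  rw [hs, Submodule.span_singleton_smul_eq (Ne.isUnit fun hc => hu0 (by rw [hc, zero_smul]))]

namespace IsAlmostFeffermanRobinson

variable (hM : IsAlmostFeffermanRobinson m g R Rs ν νs J) (x : M)
include hM

lemma symm (u v : TangentSpace 𝓘(ℝ, E) x) : g x u v = g x v u := hM.lorentzian.symm x u v

lemma null : g x (ν x) (ν x) = 0 :=
  hM.optical.null_line.null x _ (hM.pairing.mem x) _ (hM.pairing.mem x)

lemma null_dual : g x (νs x) (νs x) = 0 :=
  hM.optical.null_line_dual.null x _ (hM.pairing.mem_dual x) _ (hM.pairing.mem_dual x)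

lemma pair : g x (ν x) (νs x) = 1 := hM.pairing.pairing x

lemma pair' : g x (νs x) (ν x) = 1 := by rw [hM.symm, hM.pair]

lemma line_eq : R x = Submodule.span ℝ {ν x} :=
  hM.optical.null_line.eq_span (hM.pairing.mem x) fun h0 => by simpa [h0] using hM.pair x

lemma line_dual_eq : Rs x = Submodule.span ℝ {νs x} :=
  hM.optical.null_line_dual.eq_span (hM.pairing.mem_dual x) fun h0 => by simpa [h0] using hM.pair x

lemma mem_orth_iff (v : TangentSpace 𝓘(ℝ, E) x) : v ∈ orth g R x ↔ g x (ν x) v = 0 := by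
  refine ⟨fun h => h _ (hM.pairing.mem x), fun h u hu => ?_⟩
  rw [hM.line_eq x, Submodule.mem_span_singleton] at hu
  obtain ⟨c, rfl⟩ := hu
  simp [h]

lemma mem_orth_dual_iff (v : TangentSpace 𝓘(ℝ, E) x) : v ∈ orth g Rs x ↔ g x (νs x) v = 0 := by
  refine ⟨fun h => h _ (hM.pairing.mem_dual x), fun h u hu => ?_⟩
  rw [hM.line_dual_eq x, Submodule.mem_span_singleton] at hu
  obtain ⟨c, rfl⟩ := hu
  simp [h]

lemma mem_screen_iff (v : TangentSpace 𝓘(ℝ, E) x) :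
    v ∈ screen g R Rs x ↔ g x (ν x) v = 0 ∧ g x (νs x) v = 0 := by
  rw [screen, Submodule.mem_inf, hM.mem_orth_iff, hM.mem_orth_dual_iff]

omit [IsManifold 𝓘(ℝ, E) ∞ M] hM in
lemma _root_.RobinsonGeometry.screenProj_apply (u : TangentSpace 𝓘(ℝ, E) x) :
    screenProj g ν νs x u = u - g x (νs x) u • ν x - g x (ν x) u • νs x := rfl

lemma screenProj_mem (u : TangentSpace 𝓘(ℝ, E) x) : screenProj g ν νs x u ∈ screen g R Rs x := by
  rw [hM.mem_screen_iff, screenProj_apply]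
  simp [hM.null, hM.null_dual, hM.pair, hM.pair']

lemma apply_screenProj (u : TangentSpace 𝓘(ℝ, E) x) : J x (screenProj g ν νs x u) = J x u := by
  rw [screenProj_apply]
  simp [hM.hermitian.zero_left x _ (hM.pairing.mem x),
    hM.hermitian.zero_right x _ (hM.pairing.mem_dual x)]

lemma apply_mem (u : TangentSpace 𝓘(ℝ, E) x) : J x u ∈ screen g R Rs x := by
  rw [← hM.apply_screenProj]
  exact hM.hermitian.maps_screen x _ (hM.screenProj_mem x u)

/-- This lets the screen projection be traded for powers of `J` throughout; in particular $Ju=0$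
forces $u_{\mathcal S}=0$. -/
lemma sq (u : TangentSpace 𝓘(ℝ, E) x) : J x (J x u) = -screenProj g ν νs x u := by
  rw [← hM.apply_screenProj x u, hM.hermitian.sq x _ (hM.screenProj_mem x u)]

lemma cube (u : TangentSpace 𝓘(ℝ, E) x) : J x (J x (J x u)) = -J x u := by
  rw [hM.sq x u, map_neg, hM.apply_screenProj]

lemma metric_apply_screenProj (u v : TangentSpace 𝓘(ℝ, E) x) :
    g x (J x u) (screenProj g ν νs x v) = g x (J x u) v := by
  have h := (hM.mem_screen_iff x _).1 (hM.apply_mem x u)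
  rw [screenProj_apply]
  simp [hM.symm x (J x u) (ν x), hM.symm x (J x u) (νs x), h.1, h.2]

/-- Orthogonality of `J` applied to $Ju$ and $v_{\mathcal S}$, together with $J^2u=-u_{\mathcal S}$.
-/
lemma skew (u v : TangentSpace 𝓘(ℝ, E) x) : g x (J x u) v = -g x u (J x v) := by
  have h1 := hM.hermitian.orthogonal x _ (hM.apply_mem x u) _ (hM.screenProj_mem x v)
  rw [hM.apply_screenProj, hM.sq, hM.metric_apply_screenProj, map_neg, neg_apply, hM.symm,
    hM.metric_apply_screenProj, hM.symm] at h1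
  exact h1.symm

variable [FiniteDimensional ℝ E]

lemma smooth_field {z : M} {y : E} (hy : y ∈ (extChartAt 𝓘(ℝ, E) z).target) :
    ContDiffAt ℝ ∞ (chartField z ν) y :=
  have : CompleteSpace E := FiniteDimensional.complete ℝ E
  contDiffAt_chartField hM.pairing.smooth isOpen_univ hy trivial

lemma smooth_field_dual {z : M} {y : E} (hy : y ∈ (extChartAt 𝓘(ℝ, E) z).target) :
    ContDiffAt ℝ ∞ (chartField z νs) y :=
  have : CompleteSpace E := FiniteDimensional.complete ℝ E
  contDiffAt_chartField hM.pairing.smooth_dual isOpen_univ hy trivial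

lemma smooth_form {z : M} {y : E} (hy : y ∈ (extChartAt 𝓘(ℝ, E) z).target) :
    ContDiffAt ℝ ∞ (chartForm z (flat g ν)) y :=
  contDiffAt_chartForm_flat hM.lorentzian.smooth hM.pairing.smooth hy

lemma differentiable_field : DifferentiableAt ℝ (chartField x ν) (extChartAt 𝓘(ℝ, E) x x) :=
  (hM.smooth_field (mem_extChartAt_target x)).differentiableAt (by simp)

lemma differentiable_field_dual : DifferentiableAt ℝ (chartField x νs) (extChartAt 𝓘(ℝ, E) x x) :=
  (hM.smooth_field_dual (mem_extChartAt_target x)).differentiableAt (by simp)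

lemma differentiable_form :
    DifferentiableAt ℝ (chartForm x (flat g ν)) (extChartAt 𝓘(ℝ, E) x x) :=
  (hM.smooth_form (mem_extChartAt_target x)).differentiableAt (by simp)

lemma differentiable_form_dual :
    DifferentiableAt ℝ (chartForm x (flat g νs)) (extChartAt 𝓘(ℝ, E) x x) :=
  (contDiffAt_chartForm_flat hM.lorentzian.smooth hM.pairing.smooth_dual
    (mem_extChartAt_target x)).differentiableAt (by simp)

lemma differentiable_metric : DifferentiableAt ℝ (chartBilin x g) (extChartAt 𝓘(ℝ, E) x x) :=
  (contDiffAt_chartBilin hM.lorentzian.smooth (mem_extChartAt_target x)).differentiableAt (by simp)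

lemma differentiable_end : DifferentiableAt ℝ (chartEnd x J) (extChartAt 𝓘(ℝ, E) x x) :=
  (contDiffAt_chartEnd hM.hermitian.smooth (mem_extChartAt_target x)).differentiableAt (by simp)

/-- Cartan's formula with $\sigma^*(\nu)=0$ constant, then adaptedness; for $\nu^*$ the constant is
$1$. -/
lemma extDerivForm_field : extDerivForm (flat g ν) x (ν x) = 0 := by
  rw [extDerivForm_apply_eq_lieDerivForm (c := 0) (hM.differentiable_form x)
    (hM.differentiable_field x) fun z => hM.null z]
  exact hM.adapted.1 x

lemma extDerivForm_field_dual : extDerivForm (flat g ν) x (νs x) = 0 := by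
  rw [extDerivForm_apply_eq_lieDerivForm (c := 1) (hM.differentiable_form x)
    (hM.differentiable_field_dual x) fun z => hM.pair z]
  exact hM.adapted.2 x

omit [IsManifold 𝓘(ℝ, E) ∞ M] hM [FiniteDimensional ℝ E] in
lemma _root_.RobinsonGeometry.extDerivForm_skew
    (α : (x : M) → TangentSpace 𝓘(ℝ, E) x →L[ℝ] ℝ) (u v : TangentSpace 𝓘(ℝ, E) x) :
    extDerivForm α x u v = -extDerivForm α x v u := by
  rw [extDerivForm_eq, pullbackBilin_apply, pullbackBilin_apply, extForm_apply, extForm_apply]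
  ring

/-- The Hermitian form is the exterior derivative of `σ*`. -/
lemma hermitianForm_eq : hermitianForm g J = extDerivForm (flat g ν) := by
  funext x
  have key : ∀ u v, extDerivForm (flat g ν) x (screenProj g ν νs x u) v =
      extDerivForm (flat g ν) x u v := by
    intro u v
    rw [screenProj_apply]
    simp [hM.extDerivForm_field, hM.extDerivForm_field_dual]
  ext u v
  change g x (J x u) v = _
  rw [← key, extDerivForm_skew, ← key, ← extDerivForm_skew, ← hM.screen_eq x _
    (hM.screenProj_mem x u) _ (hM.screenProj_mem x v), hM.apply_screenProj,
    hM.metric_apply_screenProj]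

lemma lieDerivBilin_hermitianForm : lieDerivBilin ν (hermitianForm g J) x = 0 := by
  rw [hM.hermitianForm_eq]
  exact lieDerivBilin_extDerivForm (fun z y hy => hM.smooth_field hy)
    (fun z y hy => hM.smooth_form hy) hM.adapted.1 x

lemma lieDerivBilin_hermitianForm_dual : lieDerivBilin νs (hermitianForm g J) x = 0 := by
  rw [hM.hermitianForm_eq]
  exact lieDerivBilin_extDerivForm (fun z y hy => hM.smooth_field_dual hy)
    (fun z y hy => hM.smooth_form hy) hM.adapted.2 x

/-- As $\omega(\nu^*,\cdot)=0$, contracting $\mathcal L_\nu\omega=0$ with $\nu^*$ gives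
$g(J[\nu,\nu^*],\cdot)=0$. Nondegeneracy of `g` gives $J[\nu,\nu^*]=0$, and $J^2$ is minus the
screen projection. -/
lemma screenProj_mlieBracket :
    screenProj g ν νs x (VectorField.mlieBracket 𝓘(ℝ, E) ν νs x) = 0 := by
  have h1 : flat (hermitianForm g J) νs = fun _ => 0 := by
    funext z
    change g z (J z (νs z)) = 0
    rw [hM.hermitian.zero_right z _ (hM.pairing.mem_dual z), map_zero]
  have h2 : lieDerivForm ν (fun z : M => (0 : TangentSpace 𝓘(ℝ, E) z →L[ℝ] ℝ)) x = 0 := by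
    have : chartForm x (fun z : M => (0 : TangentSpace 𝓘(ℝ, E) z →L[ℝ] ℝ)) = fun _ => 0 := by
      funext y
      exact ContinuousLinearMap.zero_comp _
    rw [lieDerivForm_eq, this, lieForm]
    simp
  have h3 : J x (VectorField.mlieBracket 𝓘(ℝ, E) ν νs x) = 0 := by
    apply hM.lorentzian.eq_zero
    intro v
    have h4 := lieDerivBilin_apply_field (X := ν) (differentiableAt_chartBilin_hermitianForm
      (hM.differentiable_metric x) (hM.differentiable_end x)) (hM.differentiable_field_dual x) v
    rw [hM.lieDerivBilin_hermitianForm, h1, h2, zero_apply, zero_apply, zero_sub,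
      eq_comm, neg_eq_zero] at h4
    exact h4
  rw [← neg_eq_zero, ← hM.sq, h3, map_zero]

/-- The bracket of the optical pairing is a multiple of `ν`. -/
lemma mlieBracket_eq : VectorField.mlieBracket 𝓘(ℝ, E) ν νs x =
    g x (νs x) (VectorField.mlieBracket 𝓘(ℝ, E) ν νs x) • ν x := by
  -- The $\nu^*$-component vanishes too: $\sigma^*([\nu,\nu^*])=-d\sigma^*(\nu,\nu^*)=0$.
  have h1 := extDerivForm_apply_of_pairing_const (α := flat g ν) (c := 0) (d := 1) isOpen_univ
    trivial (hM.differentiable_form x) (hM.differentiable_field x) (hM.differentiable_field_dual x)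
    (fun z _ => hM.null z) (fun z _ => hM.pair z)
  rw [hM.extDerivForm_field, zero_apply, eq_comm, neg_eq_zero] at h1
  have h2 : g x (ν x) (VectorField.mlieBracket 𝓘(ℝ, E) ν νs x) = 0 := h1
  have h3 := hM.screenProj_mlieBracket x
  rw [screenProj_apply, h2, zero_smul, sub_zero, sub_eq_zero] at h3
  exact h3

/-- With $[\nu,\nu^*]=c\,\nu$, the contractions of $\mathcal L_\nu g$ with $\nu$ and $\nu^*$ are $0$
and $\mathcal L_\nu\sigma-c\,\sigma^*$. Splitting `u`, `v` into screen and optical components, the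
terms in `c` cancel because $(\mathcal L_\nu\sigma)(\nu^*)=-c$. -/
lemma lieDerivBilin_metric (u v : TangentSpace 𝓘(ℝ, E) x) :
    lieDerivBilin ν g x u v =
      lieDerivBilin ν g x (screenProj g ν νs x u) (screenProj g ν νs x v)
      + (g x (ν x) u * lieDerivForm ν (flat g νs) x v
        + lieDerivForm ν (flat g νs) x u * g x (ν x) v) := by
  have hs := lieDerivBilin_symm (X := ν) (hM.differentiable_metric x) hM.symm
  have h1 : ∀ w, lieDerivBilin ν g x (ν x) w = 0 := fun w => by
    rw [lieDerivBilin_apply_field (hM.differentiable_metric x) (hM.differentiable_field x),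
      hM.adapted.1 x, VectorField.mlieBracket_self]
    simp
  set c := g x (νs x) (VectorField.mlieBracket 𝓘(ℝ, E) ν νs x) with hc
  have h2 : ∀ w, lieDerivBilin ν g x (νs x) w =
      lieDerivForm ν (flat g νs) x w - c * g x (ν x) w := fun w => by
    rw [lieDerivBilin_apply_field (hM.differentiable_metric x) (hM.differentiable_field_dual x),
      hM.mlieBracket_eq, map_smul, smul_apply, smul_eq_mul]
  have h3 : lieDerivForm ν (flat g νs) x (ν x) = 0 := by
    rw [lieDerivForm_apply_of_pairing_const (c := 1) (hM.differentiable_form_dual x)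
      (hM.differentiable_field x) fun z => hM.pair' z, VectorField.mlieBracket_self]
    simp
  have h4 : lieDerivForm ν (flat g νs) x (νs x) = -c := by
    rw [lieDerivForm_apply_of_pairing_const (c := 0) (hM.differentiable_form_dual x)
      (hM.differentiable_field_dual x) fun z => hM.null_dual z]
    rfl
  have h5 : ∀ w, lieDerivBilin ν g x w (ν x) = 0 := fun w => by rw [hs, h1]
  have h6 : ∀ w, lieDerivBilin ν g x w (νs x) =
      lieDerivForm ν (flat g νs) x w - c * g x (ν x) w := fun w => by rw [hs, h2]
  simp only [screenProj_apply, map_sub, map_smul, sub_apply, smul_apply, h1, h2, h5, h6, h3, h4,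
    smul_eq_mul, hM.pair, hM.null]
  ring

lemma lieDerivBilin_metric_screenProj (u v : TangentSpace 𝓘(ℝ, E) x) :
    lieDerivBilin ν g x (screenProj g ν νs x u) (screenProj g ν νs x v) =
      -lieDerivBilin ν g x (J x u) (J x v) := by
  have h := lieDerivBilin_anti_invariant (X := ν) (hM.differentiable_metric x)
    (hM.differentiable_end x) hM.skew hM.cube (hM.lieDerivBilin_hermitianForm x) u v
  rw [hM.sq, hM.sq] at h
  simpa using h

end IsAlmostFeffermanRobinson

end FeffermanRobinson

/-! ### Real and imaginary parts in $\mathbb C\otimes V$. -/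

section Complexification

variable {V : Type*} [AddCommGroup V] [Module ℝ V]

@[simp] lemma rePart_tmul (c : ℂ) (v : V) : rePart (c ⊗ₜ[ℝ] v) = c.re • v := by simp [rePart]

@[simp] lemma imPart_tmul (c : ℂ) (v : V) : imPart (c ⊗ₜ[ℝ] v) = c.im • v := by simp [imPart]

@[simp] lemma rePart_complexVec (u v : V) : rePart (complexVec u v) = u := by simp [complexVec]

@[simp] lemma imPart_complexVec (u v : V) : imPart (complexVec u v) = v := by simp [complexVec]

lemma complexVec_add (u v u' v' : V) :
    complexVec u v + complexVec u' v' = complexVec (u + u') (v + v') := by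
  simp only [complexVec, TensorProduct.tmul_add]
  abel

lemma complexVec_rePart_imPart (Z : ℂ ⊗[ℝ] V) : complexVec (rePart Z) (imPart Z) = Z := by
  induction Z using TensorProduct.induction_on with
  | zero => simp [complexVec]
  | tmul c v =>
    rw [rePart_tmul, imPart_tmul, complexVec, ← TensorProduct.smul_tmul, ← TensorProduct.smul_tmul,
      ← TensorProduct.add_tmul]
    congr 1
    apply Complex.ext <;> simp
  | add Z W hZ hW => rw [map_add, map_add, ← complexVec_add, hZ, hW]

lemma I_smul_complexVec (u v : V) : Complex.I • complexVec u v = complexVec (-v) u := by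
  simp only [complexVec, smul_add, TensorProduct.smul_tmul', smul_eq_mul, Complex.I_mul_I, mul_one,
    TensorProduct.tmul_neg, TensorProduct.neg_tmul]
  abel

lemma baseChange_complexVec (f : V →ₗ[ℝ] V) (u v : V) :
    f.baseChange ℂ (complexVec u v) = complexVec (f u) (f v) := by
  simp [complexVec]

lemma complexVec_inj {u v u' v' : V} : complexVec u v = complexVec u' v' ↔ u = u' ∧ v = v' := by
  refine ⟨fun h => ?_, by rintro ⟨rfl, rfl⟩; rfl⟩
  have h1 := congrArg rePart h
  have h2 := congrArg imPart h
  simp only [rePart_complexVec, imPart_complexVec] at h1 h2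
  exact ⟨h1, h2⟩

lemma complexVec_mem_baseChange {p : Submodule ℝ V} {u v : V} (hu : u ∈ p) (hv : v ∈ p) :
    complexVec u v ∈ p.baseChange ℂ :=
  add_mem (Submodule.tmul_mem_baseChange_of_mem _ hu) (Submodule.tmul_mem_baseChange_of_mem _ hv)

lemma parts_mem_of_mem_baseChange {p : Submodule ℝ V} {Z : ℂ ⊗[ℝ] V} (hZ : Z ∈ p.baseChange ℂ) :
    rePart Z ∈ p ∧ imPart Z ∈ p := by
  rw [Submodule.baseChange_eq_span] at hZ
  induction hZ using Submodule.span_induction with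
  | mem Z hZ =>
    obtain ⟨v, hv, rfl⟩ := hZ
    simpa using hv
  | zero => simp
  | add Z W _ _ hZ hW => simpa using ⟨add_mem hZ.1 hW.1, add_mem hZ.2 hW.2⟩
  | smul c Z _ hZ =>
    rw [← complexVec_rePart_imPart Z, complexVec, smul_add, TensorProduct.smul_tmul',
      TensorProduct.smul_tmul']
    simp only [map_add, rePart_tmul, imPart_tmul]
    exact ⟨add_mem (p.smul_mem _ hZ.1) (p.smul_mem _ hZ.2),
      add_mem (p.smul_mem _ hZ.1) (p.smul_mem _ hZ.2)⟩

lemma bilinForm_complex_ext {B C : LinearMap.BilinForm ℂ (ℂ ⊗[ℝ] V)}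
    (h : ∀ u v : V, B (1 ⊗ₜ[ℝ] u) (1 ⊗ₜ[ℝ] v) = C (1 ⊗ₜ[ℝ] u) (1 ⊗ₜ[ℝ] v)) : B = C := by
  have htmul : ∀ (c : ℂ) (v : V), c ⊗ₜ[ℝ] v = c • ((1 : ℂ) ⊗ₜ[ℝ] v) := fun c v => by
    rw [TensorProduct.smul_tmul', smul_eq_mul, mul_one]
  refine LinearMap.ext fun Z => LinearMap.ext fun W => ?_
  induction Z using TensorProduct.induction_on with
  | zero => simp
  | add Z Z' hZ hZ' => simp [hZ, hZ']
  | tmul c u =>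
    induction W using TensorProduct.induction_on with
    | zero => simp
    | add W W' hW hW' => simp only [map_add, hW, hW']
    | tmul d v => rw [htmul c, htmul d]; simp only [map_smul, LinearMap.smul_apply, h]

end Complexification

/-! ### The Robinson bundle: type decomposition and partial integrability. -/

section RobinsonBundle

variable {E : Type*} [NormedAddCommGroup E] [NormedSpace ℝ E]
  {M : Type*} [TopologicalSpace M] [ChartedSpace E M] [IsManifold 𝓘(ℝ, E) ∞ M] {m : ℕ}
  {g : (x : M) → TangentSpace 𝓘(ℝ, E) x →L[ℝ] TangentSpace 𝓘(ℝ, E) x →L[ℝ] ℝ}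
  {R Rs : (x : M) → Submodule ℝ (TangentSpace 𝓘(ℝ, E) x)}
  {ν νs : (x : M) → TangentSpace 𝓘(ℝ, E) x}
  {J : (x : M) → TangentSpace 𝓘(ℝ, E) x →L[ℝ] TangentSpace 𝓘(ℝ, E) x}

omit [IsManifold 𝓘(ℝ, E) ∞ M] in
lemma complexExt_one_tmul {x : M}
    (h : TangentSpace 𝓘(ℝ, E) x →L[ℝ] TangentSpace 𝓘(ℝ, E) x →L[ℝ] ℝ)
    (u v : TangentSpace 𝓘(ℝ, E) x) :
    complexExt h (1 ⊗ₜ[ℝ] u) (1 ⊗ₜ[ℝ] v) = (h u v : ℂ) := by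
  simp [complexExt]

omit [IsManifold 𝓘(ℝ, E) ∞ M] in
-- In $\tfrac14\big(h(u-iJu,v-iJv)+h(u+iJu,v+iJv)\big)$ the cross terms cancel. The $(2,0)+(0,2)$
-- part is thus the `J`-anti-invariant part on the screen.
lemma part2002_one_tmul {x : M}
    (h : TangentSpace 𝓘(ℝ, E) x →L[ℝ] TangentSpace 𝓘(ℝ, E) x →L[ℝ] ℝ)
    (u v : TangentSpace 𝓘(ℝ, E) x) :
    part2002 g ν νs J x h (1 ⊗ₜ[ℝ] u) (1 ⊗ₜ[ℝ] v) =
      ((1 / 2 * (h (screenProj g ν νs x u) (screenProj g ν νs x v) -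
        h (J x (screenProj g ν νs x u)) (J x (screenProj g ν νs x v))) : ℝ) : ℂ) := by
  have hI : Complex.I * Complex.I = -1 := Complex.I_mul_I
  simp only [part2002, proj10, proj01, LinearMap.add_apply, LinearMap.BilinForm.comp_apply,
    LinearMap.comp_apply, LinearMap.baseChange_tmul, LinearMap.smul_apply, LinearMap.sub_apply,
    LinearMap.id_apply, map_add, map_sub, map_smul, complexExt_one_tmul, smul_eq_mul,
    ContinuousLinearMap.coe_coe]
  push_cast
  linear_combination (1 / 2 * (h (J x (screenProj g ν νs x u))
    (J x (screenProj g ν νs x v)) : ℂ)) * hI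

namespace IsAlmostFeffermanRobinson

variable (hM : IsAlmostFeffermanRobinson m g R Rs ν νs J)
include hM

lemma complexExt_lieDerivBilin_metric [FiniteDimensional ℝ E] (x : M) :
    complexExt (lieDerivBilin ν g x) =
      part2002 g ν νs J x (lieDerivBilin ν g x) +
      LinearMap.BilinForm.baseChange ℂ (symProd (flat g ν x).toLinearMap
        (lieDerivForm ν (flat g νs) x).toLinearMap) := by
  apply bilinForm_complex_ext
  intro u v
  have h1 := hM.lieDerivBilin_metric_screenProj x u v
  rw [LinearMap.add_apply, LinearMap.add_apply, complexExt_one_tmul, part2002_one_tmul,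
    hM.apply_screenProj, hM.apply_screenProj, ← neg_eq_iff_eq_neg.2 h1, hM.lieDerivBilin_metric x u v]
  simp [symProd, flat]
  ring

/-- These are the real and imaginary parts of $\sigma^*(Z)=0$ and $JZ=iZ_{\mathcal S}$. The latter
holds on $\mathcal R^{\mathbb C}$, where both sides vanish, and on $\mathcal S^{1,0}$ by definition.
-/
lemma parts_of_mem_robinsonBundle {x : M} {Z : ℂ ⊗[ℝ] TangentSpace 𝓘(ℝ, E) x}
    (hZ : Z ∈ robinsonBundle g R Rs J x) :
    g x (ν x) (rePart Z) = 0 ∧ g x (ν x) (imPart Z) = 0 ∧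
      J x (rePart Z) = -screenProj g ν νs x (imPart Z) ∧
      J x (imPart Z) = screenProj g ν νs x (rePart Z) := by
  obtain ⟨r, hr, s, hs, rfl⟩ := Submodule.mem_sup.1 hZ
  obtain ⟨hs1, hs2⟩ := hs
  have hr1 := parts_mem_of_mem_baseChange hr
  have hR : ∀ w ∈ R x, g x (ν x) w = 0 ∧ J x w = 0 ∧ screenProj g ν νs x w = 0 := by
    intro w hw
    refine ⟨hM.optical.null_line.null x _ (hM.pairing.mem x) _ hw, hM.hermitian.zero_left x _ hw, ?_⟩
    rw [← neg_eq_zero, ← hM.sq, hM.hermitian.zero_left x _ hw, map_zero]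
  have hS := parts_mem_of_mem_baseChange hs1
  have hP : ∀ w ∈ screen g R Rs x, screenProj g ν νs x w = w := fun w hw => by
    rw [← neg_inj, ← hM.sq, hM.hermitian.sq x w hw]
  have he := Module.End.mem_eigenspace_iff.1 hs2
  rw [← complexVec_rePart_imPart s, baseChange_complexVec, I_smul_complexVec, complexVec_inj] at he
  obtain ⟨e1, e2⟩ := he
  simp only [ContinuousLinearMap.coe_coe] at e1 e2
  simp only [map_add, (hR _ hr1.1).1, (hR _ hr1.1).2.1, (hR _ hr1.1).2.2, (hR _ hr1.2).1,
    (hR _ hr1.2).2.1, (hR _ hr1.2).2.2, zero_add, hP _ hS.1, hP _ hS.2, e1, e2,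
    ((hM.mem_screen_iff x _).1 hS.1).1, ((hM.mem_screen_iff x _).1 hS.2).1, and_self]

lemma complexVec_mem_screen10 {x : M} {s : TangentSpace 𝓘(ℝ, E) x}
    (hs : s ∈ screen g R Rs x) : complexVec s (-J x s) ∈ screen10 g R Rs J x := by
  refine ⟨complexVec_mem_baseChange hs (neg_mem (hM.apply_mem x s)), ?_⟩
  refine Module.End.mem_eigenspace_iff.2 ?_
  rw [baseChange_complexVec, I_smul_complexVec, complexVec_inj]
  simp [hM.hermitian.sq x s hs]

/-- The inclusion $(\mathcal R^\perp)^{\mathbb C}\subset\mathcal N+\overline{\mathcal N}$, which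
reduces partial integrability to the vanishing of $\sigma^*$ on brackets. -/
lemma exists_add_conjVec {x : M} {a b : TangentSpace 𝓘(ℝ, E) x} (ha : g x (ν x) a = 0)
    (hb : g x (ν x) b = 0) : ∃ A ∈ robinsonBundle g R Rs J x, ∃ B ∈ robinsonBundle g R Rs J x,
      complexVec a b = A + conjVec B := by
  set a' := screenProj g ν νs x a with ha'
  set b' := screenProj g ν νs x b with hb'
  have hsa : a' ∈ screen g R Rs x := hM.screenProj_mem x a
  have hsb : b' ∈ screen g R Rs x := hM.screenProj_mem x b
  have ea : a = g x (νs x) a • ν x + a' := by rw [ha', screenProj_apply, ha]; simp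
  have eb : b = g x (νs x) b • ν x + b' := by rw [hb', screenProj_apply, hb]; simp
  -- The $(1,0)$ and $(0,1)$ components of $a'+ib'$ are $s-iJs$ and $t+iJt$ with
  -- $s=\tfrac12(a'+Jb')$ and $t=\tfrac12(a'-Jb')$; the second is the conjugate of $t-iJt$.
  have h1 : (1 / 2 : ℝ) • (a' + J x b') ∈ screen g R Rs x :=
    Submodule.smul_mem _ _ (add_mem hsa (hM.apply_mem x b'))
  have h2 : (1 / 2 : ℝ) • (a' - J x b') ∈ screen g R Rs x :=
    Submodule.smul_mem _ _ (sub_mem hsa (hM.apply_mem x b'))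
  have hν : ∀ c : ℝ, c • ν x ∈ R x := fun c => Submodule.smul_mem _ _ (hM.pairing.mem x)
  refine ⟨complexVec (g x (νs x) a • ν x) (g x (νs x) b • ν x) + _,
    Submodule.add_mem_sup (complexVec_mem_baseChange (hν _) (hν _)) (hM.complexVec_mem_screen10 h1),
    _, Submodule.mem_sup_right (hM.complexVec_mem_screen10 h2), ?_⟩
  rw [conjVec, rePart_complexVec, imPart_complexVec, complexVec_add, complexVec_add, complexVec_inj]
  have ja := hM.hermitian.sq x _ hsa
  have jb := hM.hermitian.sq x _ hsb
  simp only [map_smul, map_add, map_sub, jb]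
  constructor
  · nth_rewrite 1 [ea]
    module
  · nth_rewrite 1 [eb]
    module

lemma metric_mlieBracket [FiniteDimensional ℝ E] {U : Set M}
    {Y Z : (x : M) → TangentSpace 𝓘(ℝ, E) x} (hU : IsOpen U) (hY : IsSmoothFieldOn Y U)
    (hZ : IsSmoothFieldOn Z U) (hY0 : ∀ x ∈ U, g x (ν x) (Y x) = 0)
    (hZ0 : ∀ x ∈ U, g x (ν x) (Z x) = 0) {x : M} (hx : x ∈ U) :
    g x (ν x) (VectorField.mlieBracket 𝓘(ℝ, E) Y Z x) = -g x (J x (Y x)) (Z x) := by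
  have : CompleteSpace E := FiniteDimensional.complete ℝ E
  have hxU : (extChartAt 𝓘(ℝ, E) x).symm (extChartAt 𝓘(ℝ, E) x x) ∈ U := by
    rwa [extChartAt_to_inv]
  have h := extDerivForm_apply_of_pairing_const (α := flat g ν) hU hx (hM.differentiable_form x)
    ((contDiffAt_chartField hY hU (mem_extChartAt_target x) hxU).differentiableAt (by simp))
    ((contDiffAt_chartField hZ hU (mem_extChartAt_target x) hxU).differentiableAt (by simp))
    hY0 hZ0
  rw [← hM.hermitianForm_eq] at h
  exact (neg_eq_iff_eq_neg.2 h).symm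

/-- $\mathcal N$ is totally isotropic for $\omega=d\sigma^*$, and $\sigma^*$ kills its sections, so
$\sigma^*$ also kills their brackets. -/
lemma partiallyIntegrable [FiniteDimensional ℝ E] :
    PartiallyIntegrable (robinsonBundle g R Rs J) := by
  intro U Z W hU hZ hW hZN hWN x hx
  have pZ := fun y hy => hM.parts_of_mem_robinsonBundle (hZN y hy)
  have pW := fun y hy => hM.parts_of_mem_robinsonBundle (hWN y hy)
  have brr := hM.metric_mlieBracket hU hZ.1 hW.1 (fun y hy => (pZ y hy).1)
    (fun y hy => (pW y hy).1) hx
  have bii := hM.metric_mlieBracket hU hZ.2 hW.2 (fun y hy => (pZ y hy).2.1)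
    (fun y hy => (pW y hy).2.1) hx
  have bri := hM.metric_mlieBracket hU hZ.1 hW.2 (fun y hy => (pZ y hy).1)
    (fun y hy => (pW y hy).2.1) hx
  have bir := hM.metric_mlieBracket hU hZ.2 hW.1 (fun y hy => (pZ y hy).2.1)
    (fun y hy => (pW y hy).1) hx
  obtain ⟨-, -, z1, -⟩ := pZ x hx
  obtain ⟨-, -, w1, w2⟩ := pW x hx
  have jj : J x (J x (rePart (Z x))) = -J x (imPart (Z x)) := by
    rw [z1, map_neg, hM.apply_screenProj]
  -- `e1` and `e2` are the real and imaginary parts of $\omega(Z,W)=0$.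
  have e1 : g x (J x (rePart (Z x))) (rePart (W x)) = g x (J x (imPart (Z x))) (imPart (W x)) := by
    rw [← hM.metric_apply_screenProj, ← w2, ← neg_inj, ← hM.skew, jj, map_neg, neg_apply]
  have e2 : g x (J x (rePart (Z x))) (imPart (W x)) =
      -g x (J x (imPart (Z x))) (rePart (W x)) := by
    rw [← hM.metric_apply_screenProj, ← neg_eq_iff_eq_neg.2 w1, map_neg, ← hM.skew, jj, map_neg,
      neg_apply]
  apply hM.exists_add_conjVec
  · rw [map_sub, brr, bii, e1, sub_self]
  · rw [map_add, bri, bir, e2]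
    ring

end IsAlmostFeffermanRobinson

end RobinsonBundle

end RobinsonGeometry

end

theorem proposition2p1 (m : ℕ) {M : Type*} [TopologicalSpace M]
    [ChartedSpace (EuclideanSpace ℝ (Fin (2 * m + 2))) M]
    [IsManifold 𝓘(ℝ, EuclideanSpace ℝ (Fin (2 * m + 2))) ∞ M]
    (g : (x : M) → TangentSpace 𝓘(ℝ, EuclideanSpace ℝ (Fin (2 * m + 2))) x →L[ℝ]
      TangentSpace 𝓘(ℝ, EuclideanSpace ℝ (Fin (2 * m + 2))) x →L[ℝ] ℝ)
    (R Rs : (x : M) → Submodule ℝ (TangentSpace 𝓘(ℝ, EuclideanSpace ℝ (Fin (2 * m + 2))) x))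
    (ν νs : (x : M) → TangentSpace 𝓘(ℝ, EuclideanSpace ℝ (Fin (2 * m + 2))) x)
    (J : (x : M) → TangentSpace 𝓘(ℝ, EuclideanSpace ℝ (Fin (2 * m + 2))) x →L[ℝ]
      TangentSpace 𝓘(ℝ, EuclideanSpace ℝ (Fin (2 * m + 2))) x)
    (hM : RobinsonGeometry.IsAlmostFeffermanRobinson m g R Rs ν νs J) :
    RobinsonGeometry.PartiallyIntegrable (RobinsonGeometry.robinsonBundle g R Rs J) ∧
    (∀ x, RobinsonGeometry.lieDerivBilin ν (RobinsonGeometry.hermitianForm g J) x = 0) ∧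
    (∀ x, RobinsonGeometry.lieDerivBilin νs (RobinsonGeometry.hermitianForm g J) x = 0) ∧
    (∀ x, RobinsonGeometry.screenProj g ν νs x
      (VectorField.mlieBracket 𝓘(ℝ, EuclideanSpace ℝ (Fin (2 * m + 2))) ν νs x) = 0) ∧
    (∀ x, RobinsonGeometry.complexExt (RobinsonGeometry.lieDerivBilin ν g x) =
      RobinsonGeometry.part2002 g ν νs J x (RobinsonGeometry.lieDerivBilin ν g x) +
      LinearMap.BilinForm.baseChange ℂ (RobinsonGeometry.symProd
        (RobinsonGeometry.flat g ν x).toLinearMap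
        (RobinsonGeometry.lieDerivForm ν (RobinsonGeometry.flat g νs) x).toLinearMap)) :=
  ⟨hM.partiallyIntegrable, fun x => hM.lieDerivBilin_hermitianForm x,
    fun x => hM.lieDerivBilin_hermitianForm_dual x, fun x => hM.screenProj_mlieBracket x,
    fun x => hM.complexExt_lieDerivBilin_metric x⟩
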